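/- Let $V$ be a finite-dimensional real normed space, $m\in\mathbb N$ and $1\le p<\infty$. Let $T^{(m)}(V)=T(V)/\bigoplus_{n>m}V^{\otimes n}$ be the truncated tensor algebra, let $\mathfrak g^m(V)$ be the Lie subalgebra of $T^{(m)}(V)$ generated by $V$, with bracket $[a,b]=a\otimes b-b\otimes a$, and let $G^m(V)=\exp(\mathfrak g^m(V))$ be the free nilpotent group of step $m$, with product $\otimes$. A $G^m(V)$-valued path is a continuous map $Y:[0,1]\to G^m(V)$ with $Y_0=1$; write $Y_{s,t}=Y_s^{-1}\otimes Y_t$. Smooth $V$-valued paths are $C^\infty$ maps $y:[0,1]\to V$ with $y_0=0$, and $$S_m(y)_{s,t}=\sum_{k=0}^m\int_{s<u_1<\cdots<u_k<t}dy_{u_1}\otimes\cdots\otimes dy_{u_k},\qquad S_m(y)_t=S_m(y)_{0,t}.$$ Let $\|g\|=\inf\{\int_0^1|\dot y_r|\,dr: y \text{ smooth},\ S_m(y)_{0,1}=g\}$ be the Carnot–Carathéodory norm on $G^m(V)$ and $d(g,h)=\|g^{-1}\otimes h\|$. For $r\ge1$ put $$d_{r\text{-var}}(X,Y)=\sup_{0=t_0<\cdots<t_n=1}\Big(\sum_{i=0}^{n-1}d(X_{t_i,t_{i+1}},Y_{t_i,t_{i+1}})^r\Big)^{1/r},\qquad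 \|Y\|_{r\text{-var}}=d_{r\text{-var}}(Y,1),$$ where $1$ also denotes the constant path. Theorem. Let $Y$ be a $G^m(V)$-valued path. Then $\|Y\|_{p\text{-var}}<\infty$ if and only if there is a sequence of smooth $V$-valued paths $y(n)$ such that (i) $\sup_n\|S_m(y(n))\|_{p\text{-var}}<\infty$; (ii) $S_m(y(n))_t\to Y_t$ for every $t\in[0,1]$. Moreover, if $\|Y\|_{p\text{-var}}<\infty$ and $(D_n)$ is any sequence of subdivisions of $[0,1]$ whose mesh tends to $0$, then there are smooth paths $y(n)$ satisfying (i) and (ii) such that each $y(n)$ is a concatenation of almost-geodesics interpolating $Y$ along $D_n$, that is, for consecutive points $s<t$ of $D_n$, $$S_m(y(n))_{s,t}=Y_{s,t}\quad\text{and}\quad\int_s^t|\dot y(n)_r|\,dr\le 2\|Y_{s,t}\|,$$ and such that $d_{q\text{-var}}(S_m(y(n)),Y)\to0$ for every $q>p$. -/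

import Mathlib

open scoped ENNReal ContDiff Topology

noncomputable section

namespace GeometricRoughPath

/-! ### The truncated tensor algebra -/

section Algebra

variable (V : Type*) [AddCommGroup V] [Module ℝ V] (m : ℕ)

/-- The ideal `⨁_{n > m} V^{⊗ n}` of the tensor algebra `T(V)`; here `V^{⊗ n} ⊆ T(V)` is the
`n`-th power of the submodule `V = range ι`. -/
def truncIdeal : Ideal (TensorAlgebra ℝ V) :=
  Ideal.span {x | ∃ n, m < n ∧ x ∈ (LinearMap.range (TensorAlgebra.ι ℝ (M := V))) ^ n}

instance truncIdeal_isTwoSided : (truncIdeal V m).IsTwoSided := by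
  have key : ∀ b a : TensorAlgebra ℝ V, a ∈ truncIdeal V m → a * b ∈ truncIdeal V m := by
    intro b
    induction b using TensorAlgebra.induction with
    | algebraMap r =>
      intro a ha
      rw [← Algebra.commutes r a]
      exact Ideal.mul_mem_left _ _ ha
    | ι v =>
      intro a ha
      unfold truncIdeal at ha ⊢
      induction ha using Submodule.span_induction with
      | mem x hx =>
        obtain ⟨n, hn, hx⟩ := hx
        refine Ideal.subset_span ⟨n + 1, by omega, ?_⟩
        rw [pow_succ]
        exact Submodule.mul_mem_mul hx ⟨v, rfl⟩
      | zero => simp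
      | add x y _ _ hx hy => rw [add_mul]; exact Ideal.add_mem _ hx hy
      | smul r x _ hx => rw [smul_eq_mul, mul_assoc]; exact Ideal.mul_mem_left _ _ hx
    | mul x y hx hy =>
      intro a ha
      rw [← mul_assoc]
      exact hy _ (hx _ ha)
    | add x y hx hy =>
      intro a ha
      rw [mul_add]
      exact Ideal.add_mem _ (hx _ ha) (hy _ ha)
  exact ⟨fun {a} b ha => key b a ha⟩

/-- The truncated tensor algebra `T^{(m)}(V) = T(V) / ⨁_{n > m} V^{⊗ n}`. -/
def TruncTensor : Type _ := TensorAlgebra ℝ V ⧸ truncIdeal V m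

instance : Ring (TruncTensor V m) := inferInstanceAs (Ring (TensorAlgebra ℝ V ⧸ truncIdeal V m))

instance : Algebra ℝ (TruncTensor V m) :=
  inferInstanceAs (Algebra ℝ (TensorAlgebra ℝ V ⧸ truncIdeal V m))

/-- The commutator bracket `[a,b] = a ⊗ b - b ⊗ a`. -/
instance : LieRing (TruncTensor V m) := LieRing.ofAssociativeRing

instance : LieAlgebra ℝ (TruncTensor V m) := LieAlgebra.ofAssociativeAlgebra

/-- The projection `T(V) → T^{(m)}(V)`. -/
def TruncTensor.mk : TensorAlgebra ℝ V →ₐ[ℝ] TruncTensor V m :=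
  Ideal.Quotient.mkₐ ℝ (truncIdeal V m)

/-- The canonical map `V → T^{(m)}(V)`. -/
def TruncTensor.ι : V →ₗ[ℝ] TruncTensor V m :=
  (TruncTensor.mk V m).toLinearMap ∘ₗ TensorAlgebra.ι ℝ

instance [Module.Finite ℝ V] : Module.Finite ℝ (TruncTensor V m) := by
  set L : Submodule ℝ (TensorAlgebra ℝ V) := LinearMap.range (TensorAlgebra.ι ℝ (M := V)) with hL
  have hLfg : L.FG := by
    rw [hL, LinearMap.range_eq_map]; exact Submodule.FG.map _ Module.Finite.fg_top
  set S : Submodule ℝ (TensorAlgebra ℝ V) := ⨆ n ∈ Finset.range (m + 1), L ^ n with hS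
  have hSfg : S.FG := Submodule.fg_biSup _ _ fun n _ => hLfg.pow n
  have htop : S.map (TruncTensor.mk V m).toLinearMap = ⊤ := by
    have hall : ∀ n, (L ^ n).map (TruncTensor.mk V m).toLinearMap
        ≤ S.map (TruncTensor.mk V m).toLinearMap := by
      intro n
      by_cases hn : n < m + 1
      · exact Submodule.map_mono (le_biSup (fun n => L ^ n) (Finset.mem_range.2 hn))
      · rintro _ ⟨x, hx, rfl⟩
        have : (TruncTensor.mk V m).toLinearMap x = 0 :=
          Ideal.Quotient.eq_zero_iff_mem.2 (Ideal.subset_span ⟨n, by omega, hx⟩)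
        rw [this]; exact Submodule.zero_mem _
    have h1 : (⨆ n, L ^ n) = (⊤ : Submodule ℝ (TensorAlgebra ℝ V)) :=
      (DirectSum.Decomposition.isInternal
        (fun n => (LinearMap.range (TensorAlgebra.ι ℝ (M := V))) ^ n)).submodule_iSup_eq_top
    have h2 : (⊤ : Submodule ℝ (TensorAlgebra ℝ V)).map (TruncTensor.mk V m).toLinearMap = ⊤ := by
      rw [Submodule.map_top, LinearMap.range_eq_top]
      exact Ideal.Quotient.mkₐ_surjective ℝ (truncIdeal V m)
    rw [eq_top_iff, ← h2, ← h1, Submodule.map_iSup]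
    exact iSup_le hall
  exact ⟨htop ▸ hSfg.map _⟩

end Algebra

section Norm

variable (V : Type*) [NormedAddCommGroup V] [NormedSpace ℝ V] [FiniteDimensional ℝ V] (m : ℕ)

/-- A norm on the finite-dimensional space `T^{(m)}(V)` (the sup norm of the coordinates in some
basis). It only serves to provide the topology and the integral of `T^{(m)}(V)`-valued functions,
which do not depend on the choice of the norm. -/
instance : NormedAddCommGroup (TruncTensor V m) :=
  NormedAddCommGroup.induced (TruncTensor V m) _
    ((Module.finBasis ℝ (TruncTensor V m)).equivFun.toLinearMap)
    (Module.finBasis ℝ (TruncTensor V m)).equivFun.injective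

instance : NormedSpace ℝ (TruncTensor V m) :=
  NormedSpace.induced ℝ (TruncTensor V m) _
    ((Module.finBasis ℝ (TruncTensor V m)).equivFun.toLinearMap)

end Norm

variable {V : Type*} [NormedAddCommGroup V] [NormedSpace ℝ V] [FiniteDimensional ℝ V]

/-! ### The free nilpotent group -/

variable (V) in
/-- The Lie subalgebra of `T^{(m)}(V)` generated by `V`: the free
nilpotent Lie algebra of step `m`. -/
def freeNilLieAlgebra (m : ℕ) : LieSubalgebra ℝ (TruncTensor V m) :=
  LieSubalgebra.lieSpan ℝ (TruncTensor V m) (Set.range (TruncTensor.ι V m))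

/-- The exponential series on `T^{(m)}(V)`, for elements without constant term: all their powers
of exponent greater than `m` vanish. -/
def texp (m : ℕ) (x : TruncTensor V m) : TruncTensor V m :=
  ∑ k ∈ Finset.range (m + 1), ((k.factorial : ℝ)⁻¹) • x ^ k

variable (V) in
/-- The free nilpotent group `G^m(V) = exp(𝔤^m(V))`. All its elements are units of
`T^{(m)}(V)`, and the group inverse is the inverse `Ring.inverse` of `T^{(m)}(V)`. -/
def freeNilGroup (m : ℕ) : Set (TruncTensor V m) :=
  texp m '' (freeNilLieAlgebra V m : Set (TruncTensor V m))

/-! ### Smooth paths and their signatures -/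

variable (V) in
/-- Infinitely differentiable paths `[0,1] → V` starting at the neutral element `0` of `V`. Only
the values on `[0,1]` matter. -/
structure SmoothPath where
  toFun : ℝ → V
  smooth : ContDiffOn ℝ ∞ toFun (Set.Icc 0 1)
  zero : toFun 0 = 0

/-- The derivative of a smooth path (one-sided at the endpoints of `[0,1]`). -/
def SmoothPath.deriv (y : SmoothPath V) (r : ℝ) : V := derivWithin y.toFun (Set.Icc 0 1) r

/-- The length `∫_s^t |ẏ_r| dr` of a smooth path over `[s,t]`. -/
def SmoothPath.length (y : SmoothPath V) (s t : ℝ) : ℝ≥0∞ := ∫⁻ r in Set.Icc s t, ‖y.deriv r‖ₑ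

/-- The iterated integrals `∫_{s<u₁<⋯<u_k<t} dy_{u₁} ⊗ ⋯ ⊗ dy_{u_k}`, as elements of
`T^{(m)}(V)`. -/
def SmoothPath.iterInt (m : ℕ) (y : SmoothPath V) : ℕ → ℝ → ℝ → TruncTensor V m
  | 0, _, _ => 1
  | k + 1, s, t => ∫ u in s..t, y.iterInt m k s u * TruncTensor.ι V m (y.deriv u)

/-- The step-`m` signature `S_m(y)_{s,t}`. -/
def SmoothPath.sig (m : ℕ) (y : SmoothPath V) (s t : ℝ) : TruncTensor V m :=
  ∑ k ∈ Finset.range (m + 1), y.iterInt m k s t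

/-- The signature path `t ↦ S_m(y)_t = S_m(y)_{0,t}`. -/
def SmoothPath.sigPath (m : ℕ) (y : SmoothPath V) (t : ℝ) : TruncTensor V m := y.sig m 0 t

/-! ### The Carnot–Carathéodory norm and variation distances -/

/-- The Carnot–Carathéodory norm: the infimum of the lengths of smooth paths with signature `g`. -/
def ccNorm (m : ℕ) (g : TruncTensor V m) : ℝ≥0∞ :=
  ⨅ (y : SmoothPath V) (_ : y.sig m 0 1 = g), y.length 0 1

/-- The left-invariant distance `d_m(g,h) = ‖g⁻¹ ⊗ h‖`. -/
def ccDist (m : ℕ) (g h : TruncTensor V m) : ℝ≥0∞ := ccNorm m (Ring.inverse g * h)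

/-- The increment `Y_{s,t} = Y_s⁻¹ ⊗ Y_t` of a path. -/
def incr {m : ℕ} (Y : ℝ → TruncTensor V m) (s t : ℝ) : TruncTensor V m := Ring.inverse (Y s) * Y t

/-- Subdivisions `0 = t_0 < t_1 < ⋯ < t_n = 1` of `[0,1]`. -/
structure Subdivision where
  n : ℕ
  t : Fin (n + 1) → ℝ
  strictMono : StrictMono t
  t_zero : t 0 = 0
  t_last : t (Fin.last n) = 1

/-- The mesh `max_i (t_{i+1} - t_i)`. -/
def Subdivision.mesh (D : Subdivision) : ℝ := ⨆ i : Fin D.n, (D.t i.succ - D.t i.castSucc)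

/-- The `p`-variation distance between paths (with values in `[0,∞]`). -/
def pVarDist (m : ℕ) (p : ℝ) (X Y : ℝ → TruncTensor V m) : ℝ≥0∞ :=
  ⨆ D : Subdivision, (∑ i : Fin D.n, ccDist m (incr X (D.t i.castSucc) (D.t i.succ))
    (incr Y (D.t i.castSucc) (D.t i.succ)) ^ p) ^ (1 / p)

/-- `‖Y‖_{p-var}`, the `p`-variation distance of `Y` to the constant path at the neutral
element. -/
def pVarNorm (m : ℕ) (p : ℝ) (Y : ℝ → TruncTensor V m) : ℝ≥0∞ := pVarDist m p Y (fun _ => 1)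

/-- `G^m(V)`-valued paths: continuous maps `[0,1] → G^m(V)` starting at the neutral element. Only
the values on `[0,1]` matter. -/
structure IsGroupPath (m : ℕ) (Y : ℝ → TruncTensor V m) : Prop where
  mem : ∀ t ∈ Set.Icc (0 : ℝ) 1, Y t ∈ freeNilGroup V m
  continuousOn : ContinuousOn Y (Set.Icc 0 1)
  zero : Y 0 = 1

variable (V) in
/-- The space `C^{p-var}(G^m(V))` of `G^m(V)`-valued paths of finite `p`-variation. -/
def CpVar (m : ℕ) (p : ℝ) : Set (ℝ → TruncTensor V m) :=
  {Y | IsGroupPath m Y ∧ pVarNorm m p Y < ⊤}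

/-- The smooth path `y` is a concatenation of almost-geodesics interpolating `Y` along the
subdivision `D`: over each interval of `D` it has the same increment as `Y`, and its length is at
most twice the Carnot–Carathéodory norm of that increment. -/
def IsAlmostGeodesicInterpolation (m : ℕ) (Y : ℝ → TruncTensor V m) (D : Subdivision)
    (y : SmoothPath V) : Prop :=
  ∀ i : Fin D.n,
    y.sig m (D.t i.castSucc) (D.t i.succ) = incr Y (D.t i.castSucc) (D.t i.succ) ∧
    y.length (D.t i.castSucc) (D.t i.succ) ≤
      2 * ccNorm m (incr Y (D.t i.castSucc) (D.t i.succ))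

end GeometricRoughPath

end

/-!
# Paths of finite `p`-variation in the free nilpotent group are limits of smooth signatures

A path `Y` of finite `p`-variation is interpolated along a fine subdivision by paths of almost
minimal length. The proof has an algebraic half, which makes the Carnot–Carathéodory norm finite
and continuous, and a half about controls, which bounds the `p`-variation of the interpolations.

**Chow's theorem.** Let `δ` be the derivation of degree of `T^{(m)}(V)` (`degDer`). The units
`g ∈ 1 + (terms of degree ≥ 1)` which normalise the free nilpotent Lie algebra `𝔤` and for which
`δ(g) g⁻¹ ∈ 𝔤` form a group, `lieGroup`. It contains every solution of `Z' = Z u` with `u` valued in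
`𝔤` and `Z = 1` initially (`exists_mem_lieGroup_of_hasDerivWithinAt`), since
`(δ(Z) Z⁻¹)' = Z δ(u) Z⁻¹`; hence it contains both `exp 𝔤`, with `u` constant, and all signatures of
smooth paths, with `u = ẏ`. No Baker–Campbell–Hausdorff formula is needed. If
`g = 1 + g_k + (terms of degree > k)` is in `lieGroup`, then `k g_k` is the leading term of
`δ(g) g⁻¹`, so that `g_k` is a Lie element. It is a combination of brackets `[v₁, [v₂, …, v_k]]`,
and these are the leading terms of group commutators of segments
(`commutator_sub_one_sub_lie_mem`). Dividing `g` by a product of such commutators raises `k`, and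
after finitely many steps `g` is the signature of a smooth path, which is short if `g` is close
to `1` (`ccNorm_lt_top`, `eventually_ccNorm_lt`). Conversely the signature of a short path is close
to `1` (`exists_forall_ccNorm_lt_mem`). Therefore the Carnot–Carathéodory norm is continuous on
`lieGroup`, and finite `p`-variation passes to pointwise limits (`pVarNorm_le_of_tendsto`).

**Interpolation.** Smooth paths are concatenated smoothly after slowing each down to a stop at its
two ends (`SmoothPath.exists_concat`). The `p`-variation of `Y` and that of its interpolation `X` are
both controlled by the increments of one function `W`, bounded independently of the subdivision
(`IsAlmostGeodesicInterpolation.exists_control`), which bounds the `p`-variation of `X` and the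
`p`-variation distance of `X` and `Y`. Both paths agree at the points of the subdivision and
oscillate little in between, hence they are uniformly close (`IsGroupPath.exists_forall_mesh_lt`).
Interpolating between the two estimates gives convergence in `q`-variation for `q > p`.
-/

noncomputable section

namespace GeometricRoughPath

/-! ### The degree filtration and the degree derivation -/

section Algebra

variable {V : Type*} [AddCommGroup V] [Module ℝ V] {m : ℕ}

theorem TruncTensor.mk_surjective : Function.Surjective (TruncTensor.mk V m) :=
  Ideal.Quotient.mkₐ_surjective ℝ (truncIdeal V m)

theorem range_ι_eq_map : LinearMap.range (TruncTensor.ι V m) =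
    (LinearMap.range (TensorAlgebra.ι ℝ (M := V))).map (TruncTensor.mk V m).toLinearMap := by
  rw [← LinearMap.range_comp]; rfl

/-- Products of more than `m` vectors vanish in `T^{(m)}(V)`. -/
theorem pow_range_ι_eq_bot {n : ℕ} (hn : m < n) :
    LinearMap.range (TruncTensor.ι V m) ^ n = ⊥ := by
  rw [range_ι_eq_map, ← Submodule.map_pow, eq_bot_iff]
  rintro _ ⟨x, hx, rfl⟩
  exact Ideal.Quotient.eq_zero_iff_mem.2 (Ideal.subset_span ⟨n, hn, hx⟩)

variable (V m) in
/-- The degree filtration of `T^{(m)}(V)`: the span of all products of at least `k` vectors. -/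
def degFilt (k : ℕ) : Submodule ℝ (TruncTensor V m) :=
  Submodule.span ℝ {x | ∃ n, k ≤ n ∧ x ∈ LinearMap.range (TruncTensor.ι V m) ^ n}

theorem mem_degFilt_of_mem_pow {k n : ℕ} (h : k ≤ n) {x : TruncTensor V m}
    (hx : x ∈ LinearMap.range (TruncTensor.ι V m) ^ n) : x ∈ degFilt V m k :=
  Submodule.subset_span ⟨n, h, hx⟩

theorem ι_mem_degFilt_one (v : V) : TruncTensor.ι V m v ∈ degFilt V m 1 :=
  mem_degFilt_of_mem_pow le_rfl (by rw [pow_one]; exact ⟨v, rfl⟩)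

theorem degFilt_anti {k l : ℕ} (h : k ≤ l) : degFilt V m l ≤ degFilt V m k :=
  Submodule.span_mono fun _ ⟨n, hn, hx⟩ => ⟨n, h.trans hn, hx⟩

theorem mul_mem_degFilt {i j : ℕ} {x y : TruncTensor V m} (hx : x ∈ degFilt V m i)
    (hy : y ∈ degFilt V m j) : x * y ∈ degFilt V m (i + j) := by
  have h := Submodule.mul_mem_mul hx hy
  unfold degFilt at h
  rw [Submodule.span_mul_span] at h
  refine Submodule.span_mono ?_ h
  rintro _ ⟨a, ⟨n, hn, ha⟩, b, ⟨k, hk, hb⟩, rfl⟩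
  refine ⟨n + k, by omega, ?_⟩
  rw [pow_add]
  exact Submodule.mul_mem_mul ha hb

theorem degFilt_zero : degFilt V m 0 = ⊤ := by
  rw [eq_top_iff]
  rintro x -
  obtain ⟨x, rfl⟩ := TruncTensor.mk_surjective x
  induction x using TensorAlgebra.induction with
  | algebraMap r =>
    rw [AlgHom.commutes]
    exact mem_degFilt_of_mem_pow le_rfl (by rw [pow_zero]; exact Submodule.algebraMap_mem r)
  | ι v => exact degFilt_anti zero_le_one (ι_mem_degFilt_one v)
  | mul x y hx hy => rw [map_mul]; simpa using mul_mem_degFilt hx hy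
  | add x y hx hy => rw [map_add]; exact add_mem hx hy

theorem mem_degFilt_zero (x : TruncTensor V m) : x ∈ degFilt V m 0 := by
  rw [degFilt_zero]; trivial

theorem degFilt_mul_right {i : ℕ} {x : TruncTensor V m} (hx : x ∈ degFilt V m i)
    (y : TruncTensor V m) : x * y ∈ degFilt V m i := by
  simpa using mul_mem_degFilt hx (mem_degFilt_zero y)

theorem degFilt_mul_left {i : ℕ} {x : TruncTensor V m} (hx : x ∈ degFilt V m i)
    (y : TruncTensor V m) : y * x ∈ degFilt V m i := by
  simpa using mul_mem_degFilt (mem_degFilt_zero y) hx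

theorem degFilt_eq_bot {k : ℕ} (hk : m < k) : degFilt V m k = ⊥ := by
  rw [eq_bot_iff]
  refine Submodule.span_le.2 ?_
  rintro x ⟨n, hn, hx⟩
  rwa [pow_range_ι_eq_bot (by omega)] at hx

theorem pow_mem_degFilt {x : TruncTensor V m} (hx : x ∈ degFilt V m 1) (k : ℕ) :
    x ^ k ∈ degFilt V m k := by
  induction k with
  | zero => exact mem_degFilt_zero _
  | succ k ih => rw [pow_succ]; exact mul_mem_degFilt ih hx

theorem pow_eq_zero_of_mem_degFilt {x : TruncTensor V m} (hx : x ∈ degFilt V m 1) {k : ℕ}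
    (hk : m < k) : x ^ k = 0 := by
  simpa [degFilt_eq_bot hk] using pow_mem_degFilt hx k

variable (V m) in
/-- The homomorphism `v ↦ (ιv, ιv)` of `T(V)` to the dual numbers over `T^{(m)}(V)`; its second
component is the derivation of degree. -/
def dualLift : TensorAlgebra ℝ V →ₐ[ℝ] TrivSqZeroExt (TruncTensor V m) (TruncTensor V m) :=
  TensorAlgebra.lift ℝ ((TrivSqZeroExt.inlAlgHom ℝ _ _).toLinearMap ∘ₗ TruncTensor.ι V m +
    (TrivSqZeroExt.inrHom (TruncTensor V m) (TruncTensor V m)).restrictScalars ℝ ∘ₗ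
      TruncTensor.ι V m)

theorem dualLift_ι (v : V) : dualLift V m (TensorAlgebra.ι ℝ v) =
    TrivSqZeroExt.inl (TruncTensor.ι V m v) + TrivSqZeroExt.inr (TruncTensor.ι V m v) := by
  simp [dualLift]

theorem fst_dualLift (x : TensorAlgebra ℝ V) : (dualLift V m x).fst = TruncTensor.mk V m x := by
  have : (TrivSqZeroExt.fstHom ℝ (TruncTensor V m) (TruncTensor V m)).comp (dualLift V m) =
      TruncTensor.mk V m := by
    ext v
    simp [dualLift_ι]
    rfl
  exact DFunLike.congr_fun this x

theorem snd_dualLift_of_mem_pow {n : ℕ} {x : TensorAlgebra ℝ V}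
    (hx : x ∈ LinearMap.range (TensorAlgebra.ι ℝ (M := V)) ^ n) :
    (dualLift V m x).snd = (n : ℝ) • TruncTensor.mk V m x := by
  induction hx using Submodule.pow_induction_on_left' with
  | algebraMap r => simp [AlgHom.commutes, TrivSqZeroExt.algebraMap_eq_inl']
  | add x y i hx hy ihx ihy => simp [ihx, ihy]
  | mem_mul v hv i x hx ih =>
    obtain ⟨v, rfl⟩ := hv
    rw [map_mul, TrivSqZeroExt.snd_mul, ih, fst_dualLift, fst_dualLift, dualLift_ι]
    simp [add_smul, TruncTensor.ι]

theorem dualLift_eq_zero {x : TensorAlgebra ℝ V} (hx : x ∈ truncIdeal V m) :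
    dualLift V m x = 0 := by
  unfold truncIdeal at hx
  induction hx using Submodule.span_induction with
  | mem x hx =>
    obtain ⟨n, hn, hx⟩ := hx
    have h0 : TruncTensor.mk V m x = 0 :=
      Ideal.Quotient.eq_zero_iff_mem.2 (Ideal.subset_span ⟨n, hn, hx⟩)
    ext
    · rw [fst_dualLift, h0]; rfl
    · rw [snd_dualLift_of_mem_pow hx, h0, smul_zero]; rfl
  | zero => exact map_zero _
  | add x y _ _ hx hy => rw [map_add, hx, hy, add_zero]
  | smul r x _ hx => rw [smul_eq_mul, map_mul, hx, mul_zero]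

variable (V m) in
/-- The derivation of degree: the derivation `δ` of `T^{(m)}(V)` with `δ(ιv) = ιv`. It multiplies
a product of `n` vectors by `n`. -/
def degDer : TruncTensor V m →ₗ[ℝ] TruncTensor V m :=
  (TrivSqZeroExt.sndHom (TruncTensor V m) (TruncTensor V m)).restrictScalars ℝ ∘ₗ
    (Ideal.Quotient.liftₐ (truncIdeal V m) (dualLift V m) fun _ h => dualLift_eq_zero h).toLinearMap

theorem degDer_mk (x : TensorAlgebra ℝ V) :
    degDer V m (TruncTensor.mk V m x) = (dualLift V m x).snd := rfl

theorem degDer_mul (x y : TruncTensor V m) :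
    degDer V m (x * y) = degDer V m x * y + x * degDer V m y := by
  obtain ⟨x, rfl⟩ := TruncTensor.mk_surjective x
  obtain ⟨y, rfl⟩ := TruncTensor.mk_surjective y
  rw [← map_mul, degDer_mk, degDer_mk, degDer_mk, map_mul, TrivSqZeroExt.snd_mul, fst_dualLift,
    fst_dualLift, add_comm]
  rfl

theorem degDer_ι (v : V) : degDer V m (TruncTensor.ι V m v) = TruncTensor.ι V m v := by
  change degDer V m (TruncTensor.mk V m _) = _
  rw [degDer_mk, dualLift_ι]
  simp

theorem degDer_one : degDer V m 1 = 0 := by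
  have h := degDer_mul (1 : TruncTensor V m) 1
  simpa using h

theorem degDer_of_mem_pow {n : ℕ} {x : TruncTensor V m}
    (hx : x ∈ LinearMap.range (TruncTensor.ι V m) ^ n) : degDer V m x = (n : ℝ) • x := by
  rw [range_ι_eq_map, ← Submodule.map_pow] at hx
  obtain ⟨x, hx, rfl⟩ := hx
  exact (degDer_mk x).trans (snd_dualLift_of_mem_pow hx)

theorem degDer_sub_smul_mem {k : ℕ} {x : TruncTensor V m} (hx : x ∈ degFilt V m k) :
    degDer V m x - (k : ℝ) • x ∈ degFilt V m (k + 1) := by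
  unfold degFilt at hx
  induction hx using Submodule.span_induction with
  | mem x hx =>
    obtain ⟨n, hn, hx⟩ := hx
    rw [degDer_of_mem_pow hx, ← sub_smul]
    rcases hn.eq_or_lt with rfl | hn
    · simp
    · exact Submodule.smul_mem _ _ (mem_degFilt_of_mem_pow hn hx)
  | zero => simp
  | add x y _ _ hx hy =>
    rw [map_add, smul_add, add_sub_add_comm]; exact add_mem hx hy
  | smul r x _ hx =>
    rw [map_smul, smul_comm, ← smul_sub]; exact Submodule.smul_mem _ _ hx

theorem degDer_mem_degFilt {k : ℕ} {x : TruncTensor V m} (hx : x ∈ degFilt V m k) :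
    degDer V m x ∈ degFilt V m k := by
  have h := add_mem (degFilt_anti k.le_succ (degDer_sub_smul_mem hx))
    (Submodule.smul_mem _ (k : ℝ) hx)
  rwa [sub_add_cancel] at h

/-- A homogeneous element of degree `j` all of whose components have degree greater than `j`
vanishes. -/
theorem eq_zero_of_degDer_eq_smul {j : ℕ} {x : TruncTensor V m}
    (hx : degDer V m x = (j : ℝ) • x) (hF : x ∈ degFilt V m (j + 1)) : x = 0 := by
  have key : ∀ n, x ∈ degFilt V m (j + 1 + n) := by
    intro n
    induction n with
    | zero => exact hF
    | succ n ih =>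
      have h := degDer_sub_smul_mem ih
      rw [hx, ← sub_smul] at h
      have hne : (j : ℝ) - ((j + 1 + n : ℕ) : ℝ) ≠ 0 := by push_cast; intro h; linarith
      exact (Submodule.smul_mem_iff _ hne).1 h
  simpa [degFilt_eq_bot (show m < j + 1 + m by omega)] using key m

/-! ### Unipotent elements -/

/-- The Neumann series, which gives the inverse of the elements of `1 + degFilt V m 1`. -/
def nilInv (g : TruncTensor V m) : TruncTensor V m := ∑ k ∈ Finset.range (m + 1), (1 - g) ^ k

theorem one_sub_pow_eq_zero {g : TruncTensor V m} (hg : g - 1 ∈ degFilt V m 1) :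
    (1 - g) ^ (m + 1) = 0 :=
  pow_eq_zero_of_mem_degFilt (by rw [← neg_sub]; exact neg_mem hg) m.lt_succ_self

theorem mul_nilInv {g : TruncTensor V m} (hg : g - 1 ∈ degFilt V m 1) : g * nilInv g = 1 := by
  have := mul_neg_geom_sum (1 - g) (m + 1)
  rwa [sub_sub_cancel, one_sub_pow_eq_zero hg, sub_zero] at this

theorem nilInv_mul {g : TruncTensor V m} (hg : g - 1 ∈ degFilt V m 1) : nilInv g * g = 1 := by
  have := geom_sum_mul_neg (1 - g) (m + 1)
  rwa [sub_sub_cancel, one_sub_pow_eq_zero hg, sub_zero] at this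

/-- The unit defined by an element of `1 + degFilt V m 1`. -/
def unipUnit (g : TruncTensor V m) (hg : g - 1 ∈ degFilt V m 1) : (TruncTensor V m)ˣ :=
  ⟨g, nilInv g, mul_nilInv hg, nilInv_mul hg⟩

theorem inv_eq_nilInv {g : (TruncTensor V m)ˣ} (hg : (g : TruncTensor V m) - 1 ∈ degFilt V m 1) :
    ((g⁻¹ : (TruncTensor V m)ˣ) : TruncTensor V m) = nilInv (g : TruncTensor V m) :=
  Units.inv_eq_of_mul_eq_one_right (mul_nilInv hg)

/-! ### Homogeneous Lie elements -/

variable (V m) in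
/-- Homogeneous Lie elements: `lieDeg V m k` is spanned by the right-normed brackets
`[v₀, [v₁, …, v_k]]` of `k + 1` vectors. -/
def lieDeg : ℕ → Submodule ℝ (TruncTensor V m)
  | 0 => LinearMap.range (TruncTensor.ι V m)
  | k + 1 => Submodule.span ℝ {x | ∃ v : V, ∃ r ∈ lieDeg k, ⁅TruncTensor.ι V m v, r⁆ = x}

theorem lie_ι_mem_lieDeg (v : V) {k : ℕ} {r : TruncTensor V m} (hr : r ∈ lieDeg V m k) :
    ⁅TruncTensor.ι V m v, r⁆ ∈ lieDeg V m (k + 1) :=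
  Submodule.subset_span ⟨v, r, hr, rfl⟩

theorem degDer_lie (x y : TruncTensor V m) :
    degDer V m ⁅x, y⁆ = ⁅degDer V m x, y⁆ + ⁅x, degDer V m y⁆ := by
  simp only [LieRing.of_associative_ring_bracket, map_sub, degDer_mul]
  abel

theorem degDer_of_mem_lieDeg {k : ℕ} {x : TruncTensor V m} (hx : x ∈ lieDeg V m k) :
    degDer V m x = ((k + 1 : ℕ) : ℝ) • x := by
  induction k generalizing x with
  | zero =>
    obtain ⟨v, rfl⟩ := hx
    simp [degDer_ι]
  | succ k ih =>
    unfold lieDeg at hx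
    induction hx using Submodule.span_induction with
    | mem x hx =>
      obtain ⟨v, r, hr, rfl⟩ := hx
      rw [degDer_lie, degDer_ι, ih hr, lie_smul]
      push_cast
      module
    | zero => simp
    | add x y _ _ hx hy => rw [map_add, hx, hy, smul_add]
    | smul r x _ hx => rw [map_smul, hx, smul_comm]

theorem lie_mem_degFilt {i j : ℕ} {x y : TruncTensor V m} (hx : x ∈ degFilt V m i)
    (hy : y ∈ degFilt V m j) : ⁅x, y⁆ ∈ degFilt V m (i + j) := by
  rw [LieRing.of_associative_ring_bracket]
  exact sub_mem (mul_mem_degFilt hx hy) (by rw [add_comm]; exact mul_mem_degFilt hy hx)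

theorem lieDeg_le_degFilt (k : ℕ) : lieDeg V m k ≤ degFilt V m (k + 1) := by
  induction k with
  | zero => rintro _ ⟨v, rfl⟩; exact ι_mem_degFilt_one v
  | succ k ih =>
    refine Submodule.span_le.2 ?_
    rintro _ ⟨v, r, hr, rfl⟩
    have := lie_mem_degFilt (ι_mem_degFilt_one v) (ih hr)
    rwa [add_comm] at this

/-- By the Jacobi identity, brackets of right-normed brackets are combinations of right-normed
brackets. -/
theorem lie_mem_lieDeg {i j : ℕ} {x y : TruncTensor V m} (hx : x ∈ lieDeg V m i)
    (hy : y ∈ lieDeg V m j) : ⁅x, y⁆ ∈ lieDeg V m (i + j + 1) := by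
  induction i generalizing x y j with
  | zero =>
    obtain ⟨v, rfl⟩ := hx
    rw [zero_add]
    exact lie_ι_mem_lieDeg v hy
  | succ i ih =>
    unfold lieDeg at hx
    induction hx using Submodule.span_induction with
    | mem x hx =>
      obtain ⟨v, r, hr, rfl⟩ := hx
      rw [lie_lie]
      refine sub_mem ?_ ?_
      · have := lie_ι_mem_lieDeg v (ih hr hy)
        rwa [show i + j + 1 + 1 = i + 1 + j + 1 by ring] at this
      · have := ih hr (lie_ι_mem_lieDeg v hy)
        rwa [show i + (j + 1) + 1 = i + 1 + j + 1 by ring] at this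
    | zero => simp
    | add x y _ _ hx hy => rw [add_lie]; exact add_mem hx hy
    | smul r x _ hx => rw [smul_lie]; exact Submodule.smul_mem _ _ hx

end Algebra

section LieAlgebra

variable {V : Type*} [NormedAddCommGroup V] [NormedSpace ℝ V] {m : ℕ}

theorem freeNilLieAlgebra_le_iSup :
    (freeNilLieAlgebra V m).toSubmodule ≤ ⨆ k, lieDeg V m k := by
  let L : LieSubalgebra ℝ (TruncTensor V m) :=
    { (⨆ k, lieDeg V m k) with
      lie_mem' := by
        intro x y hx hy
        change x ∈ ⨆ k, lieDeg V m k at hx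
        change y ∈ ⨆ k, lieDeg V m k at hy
        change ⁅x, y⁆ ∈ ⨆ k, lieDeg V m k
        induction hx using Submodule.iSup_induction' with
        | mem i x hx =>
          induction hy using Submodule.iSup_induction' with
          | mem j y hy => exact Submodule.mem_iSup_of_mem _ (lie_mem_lieDeg hx hy)
          | zero => simp
          | add y z _ _ hy hz => rw [lie_add]; exact add_mem hy hz
        | zero => simp
        | add y z _ _ hy hz => rw [add_lie]; exact add_mem hy hz }
  have : freeNilLieAlgebra V m ≤ L := by
    refine LieSubalgebra.lieSpan_le.2 ?_
    rintro _ ⟨v, rfl⟩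
    exact Submodule.mem_iSup_of_mem (p := lieDeg V m) 0 ⟨v, rfl⟩
  exact this

theorem ι_mem_freeNilLieAlgebra (v : V) : TruncTensor.ι V m v ∈ freeNilLieAlgebra V m :=
  LieSubalgebra.subset_lieSpan ⟨v, rfl⟩

theorem lieDeg_le_freeNilLieAlgebra (k : ℕ) :
    lieDeg V m k ≤ (freeNilLieAlgebra V m).toSubmodule := by
  induction k with
  | zero => rintro _ ⟨v, rfl⟩; exact ι_mem_freeNilLieAlgebra v
  | succ k ih =>
    refine Submodule.span_le.2 ?_
    rintro _ ⟨v, r, hr, rfl⟩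
    exact (freeNilLieAlgebra V m).lie_mem (ι_mem_freeNilLieAlgebra v) (ih hr)

theorem freeNilLieAlgebra_le_degFilt :
    (freeNilLieAlgebra V m).toSubmodule ≤ degFilt V m 1 :=
  freeNilLieAlgebra_le_iSup.trans <| iSup_le fun k =>
    (lieDeg_le_degFilt k).trans (degFilt_anti (by omega))

theorem degDer_mem_freeNilLieAlgebra {x : TruncTensor V m} (hx : x ∈ freeNilLieAlgebra V m) :
    degDer V m x ∈ freeNilLieAlgebra V m := by
  have key : (⨆ k, lieDeg V m k) ≤
      (freeNilLieAlgebra V m).toSubmodule.comap (degDer V m) := by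
    refine iSup_le fun k x hx => ?_
    rw [Submodule.mem_comap, degDer_of_mem_lieDeg hx]
    exact Submodule.smul_mem _ _ (lieDeg_le_freeNilLieAlgebra k hx)
  exact key (freeNilLieAlgebra_le_iSup hx)

/-- A Lie element without components of degree less than `k + 1` is the sum of a homogeneous Lie
element of degree `k + 1` and of terms of higher degree. -/
theorem mem_lieDeg_sup_degFilt {k : ℕ} {x : TruncTensor V m} (hx : x ∈ freeNilLieAlgebra V m)
    (hF : x ∈ degFilt V m (k + 1)) : x ∈ lieDeg V m k ⊔ degFilt V m (k + 2) := by
  have step : ∀ k, (⨆ n, lieDeg V m (k + n)) = lieDeg V m k ⊔ ⨆ n, lieDeg V m (k + 1 + n) := by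
    intro k
    rw [← sup_iSup_nat_succ]
    simp only [add_zero, add_assoc, add_comm 1]
  have high : ∀ k, (⨆ n, lieDeg V m (k + n)) ≤ degFilt V m (k + 1) := fun k =>
    iSup_le fun n => (lieDeg_le_degFilt _).trans (degFilt_anti (by omega))
  have key : ∀ k, x ∈ degFilt V m (k + 1) → x ∈ ⨆ n, lieDeg V m (k + n) := by
    intro k
    induction k with
    | zero => intro _; simpa using freeNilLieAlgebra_le_iSup hx
    | succ k ih =>
      intro hF
      have h := ih (degFilt_anti (by omega) hF)
      rw [step] at h
      obtain ⟨r, hr, w, hw, rfl⟩ := Submodule.mem_sup.1 h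
      -- the component `r` of degree `k + 1` vanishes, since it lies in the next filtration step
      have hr0 : r = 0 := by
        refine eq_zero_of_degDer_eq_smul (degDer_of_mem_lieDeg hr) ?_
        simpa using sub_mem hF (high (k + 1) hw)
      simpa [hr0] using hw
  have h := key k hF
  rw [step] at h
  exact sup_le_sup_left (high (k + 1)) _ h

end LieAlgebra

variable {V : Type*} [NormedAddCommGroup V] [NormedSpace ℝ V] [FiniteDimensional ℝ V] {m : ℕ}

/-! ### Calculus in the truncated tensor algebra -/

variable (V m) in
/-- Multiplication of `T^{(m)}(V)` as a continuous bilinear map. The norm of `T^{(m)}(V)` is not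
submultiplicative, so that the calculus of products goes through this map. -/
def mulCLM : TruncTensor V m →L[ℝ] TruncTensor V m →L[ℝ] TruncTensor V m :=
  (LinearMap.mul ℝ (TruncTensor V m)).toContinuousBilinearMap

@[simp] theorem mulCLM_apply (x y : TruncTensor V m) : mulCLM V m x y = x * y := rfl

instance : IsTopologicalRing (TruncTensor V m) where
  continuous_mul := (mulCLM V m).continuous₂

theorem norm_mul_le_mulCLM (x y : TruncTensor V m) : ‖x * y‖ ≤ ‖mulCLM V m‖ * ‖x‖ * ‖y‖ :=
  (mulCLM V m).le_opNorm₂ x y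

section Calculus

variable {f g : ℝ → TruncTensor V m} {f' g' : TruncTensor V m} {s : Set ℝ} {t : ℝ}

theorem hasDerivWithinAt_mul (hf : HasDerivWithinAt f f' s t) (hg : HasDerivWithinAt g g' s t) :
    HasDerivWithinAt (fun r => f r * g r) (f t * g' + f' * g t) s t :=
  (mulCLM V m).hasDerivWithinAt_of_bilinear hf hg

theorem differentiableWithinAt_pow (hf : DifferentiableWithinAt ℝ f s t) (k : ℕ) :
    DifferentiableWithinAt ℝ (fun r => f r ^ k) s t := by
  induction k with
  | zero => simp only [pow_zero]; exact differentiableWithinAt_const _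
  | succ k ih =>
    simp only [pow_succ]
    exact (hasDerivWithinAt_mul ih.hasDerivWithinAt hf.hasDerivWithinAt).differentiableWithinAt

theorem hasDerivWithinAt_linearMap {E : Type*} [NormedAddCommGroup E] [NormedSpace ℝ E]
    (L : TruncTensor V m →ₗ[ℝ] E) (hf : HasDerivWithinAt f f' s t) :
    HasDerivWithinAt (fun r => L (f r)) (L f') s t :=
  (LinearMap.toContinuousLinearMap L).hasFDerivAt.comp_hasDerivWithinAt t hf

/-- A path starting in a subspace whose derivative lies in the subspace stays there. -/
theorem mem_of_hasDerivWithinAt_mem {S : Submodule ℝ (TruncTensor V m)} {F : ℝ → TruncTensor V m}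
    {a b : ℝ} (hf : ∀ r ∈ Set.Icc a b, HasDerivWithinAt f (F r) (Set.Icc a b) r)
    (hF : ∀ r ∈ Set.Icc a b, F r ∈ S) (ha : f a ∈ S) (ht : t ∈ Set.Icc a b) : f t ∈ S := by
  by_contra h
  obtain ⟨φ, hφ, hS⟩ := Submodule.exists_le_ker_of_notMem h
  have hd : ∀ r ∈ Set.Icc a b, HasDerivWithinAt (fun r => φ (f r)) 0 (Set.Icc a b) r := by
    intro r hr
    have := hasDerivWithinAt_linearMap φ (hf r hr)
    rwa [show φ (F r) = 0 from hS (hF r hr)] at this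
  have := constant_of_derivWithin_zero (fun r hr => (hd r hr).differentiableWithinAt)
    (fun r hr => (hd r (Set.Ico_subset_Icc_self hr)).derivWithin
      (uniqueDiffOn_Icc (hr.1.trans_lt hr.2) r (Set.Ico_subset_Icc_self hr))) t ht
  exact hφ (this.trans (hS ha))

theorem intervalIntegral_mem {S : Submodule ℝ (TruncTensor V m)} {a b : ℝ}
    (hf : IntervalIntegrable f MeasureTheory.volume a b) (hS : ∀ r ∈ Set.uIcc a b, f r ∈ S) :
    ∫ r in a..b, f r ∈ S := by
  by_contra h
  obtain ⟨φ, hφ, hker⟩ := Submodule.exists_le_ker_of_notMem h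
  refine hφ ?_
  have h1 := (LinearMap.toContinuousLinearMap φ).intervalIntegral_comp_comm hf
  change ∫ r in a..b, φ (f r) = φ (∫ r in a..b, f r) at h1
  rw [← h1, intervalIntegral.integral_congr (g := fun _ => (0 : ℝ)) fun r hr => hker (hS r hr)]
  simp

end Calculus

theorem continuous_nilInv : Continuous (nilInv : TruncTensor V m → TruncTensor V m) := by
  unfold nilInv; fun_prop

/-- If `Z' = Z u` then `(Z⁻¹)' = - u Z⁻¹`. -/
theorem hasDerivWithinAt_nilInv {Z : ℝ → TruncTensor V m} {u : TruncTensor V m} {s : Set ℝ}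
    {t : ℝ} (hs : UniqueDiffWithinAt ℝ s t) (ht : t ∈ s) (hZ : HasDerivWithinAt Z (Z t * u) s t)
    (h1 : ∀ r ∈ s, Z r - 1 ∈ degFilt V m 1) :
    HasDerivWithinAt (fun r => nilInv (Z r)) (-(u * nilInv (Z t))) s t := by
  have hd : DifferentiableWithinAt ℝ (fun r => nilInv (Z r)) s t := by
    unfold nilInv
    exact DifferentiableWithinAt.fun_sum fun k _ => differentiableWithinAt_pow
      ((hZ.differentiableWithinAt).const_sub 1) k
  have h2 := hasDerivWithinAt_mul hZ hd.hasDerivWithinAt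
  have h3 : HasDerivWithinAt (fun r => Z r * nilInv (Z r)) 0 s t :=
    (hasDerivWithinAt_const t s (1 : TruncTensor V m)).congr (fun r hr => mul_nilInv (h1 r hr))
      (mul_nilInv (h1 t ht))
  have h4 := hs.eq_deriv _ h2 h3
  have h5 : derivWithin (fun r => nilInv (Z r)) s t = -(u * nilInv (Z t)) := by
    have := congrArg (nilInv (Z t) * ·) h4
    simp only [mul_add, ← mul_assoc, nilInv_mul (h1 t ht), one_mul, mul_zero] at this
    exact eq_neg_of_add_eq_zero_left this
  exact h5 ▸ hd.hasDerivWithinAt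

/-! ### The group of elements with Lie logarithmic derivative -/

variable (V m) in
/-- The units `g ∈ 1 + degFilt V m 1` that normalise the free nilpotent Lie algebra and whose
logarithmic derivative `δ(g) g⁻¹` along the derivation of degree is a Lie element. -/
def lieGroup : Subgroup (TruncTensor V m)ˣ where
  carrier := {g | (g : TruncTensor V m) - 1 ∈ degFilt V m 1 ∧
    (∀ x ∈ freeNilLieAlgebra V m, (g * x * (g⁻¹ : (TruncTensor V m)ˣ) : TruncTensor V m) ∈
      freeNilLieAlgebra V m) ∧
    degDer V m g * (g⁻¹ : (TruncTensor V m)ˣ) ∈ freeNilLieAlgebra V m}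
  one_mem' := by simp [degDer_one]
  mul_mem' := by
    rintro g h ⟨hg1, hg2, hg3⟩ ⟨hh1, hh2, hh3⟩
    refine ⟨?_, fun x hx => ?_, ?_⟩
    · have : (g * h : TruncTensor V m) - 1 = (g - 1 : TruncTensor V m) * h + (h - 1) := by
        noncomm_ring
      rw [Units.val_mul, this]
      exact add_mem (degFilt_mul_right hg1 _) hh1
    · have := hg2 _ (hh2 x hx)
      simpa [mul_assoc] using this
    · have := add_mem hg3 (hg2 _ hh3)
      simpa [degDer_mul, mul_assoc, add_mul] using this
  inv_mem' := by
    rintro g ⟨hg1, hg2, hg3⟩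
    -- conjugation by `g` is injective, hence bijective, on the finite-dimensional Lie algebra
    have hinv : ∀ x ∈ freeNilLieAlgebra V m,
        ((g⁻¹ : (TruncTensor V m)ˣ) * x * g : TruncTensor V m) ∈ freeNilLieAlgebra V m := by
      let L : TruncTensor V m →ₗ[ℝ] TruncTensor V m :=
        LinearMap.mulLeft ℝ (g : TruncTensor V m) ∘ₗ
          LinearMap.mulRight ℝ ((g⁻¹ : (TruncTensor V m)ˣ) : TruncTensor V m)
      have hLapp : ∀ x, L x = g * x * (g⁻¹ : (TruncTensor V m)ˣ) := fun x => by
        simp [L, mul_assoc]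
      have hL : ∀ x ∈ (freeNilLieAlgebra V m).toSubmodule,
          L x ∈ (freeNilLieAlgebra V m).toSubmodule := fun x hx => by
        rw [hLapp]; exact hg2 x hx
      have hback : ∀ x, ((g⁻¹ : (TruncTensor V m)ˣ) * L x * g : TruncTensor V m) = x := by
        intro x; simp [hLapp, mul_assoc]
      have hinj : Function.Injective (L.restrict hL) := by
        intro x y hxy
        have h := congrArg Subtype.val hxy
        simp only [LinearMap.restrict_apply] at h
        exact Subtype.ext (by rw [← hback x, h, hback])
      intro x hx
      obtain ⟨y, hy⟩ := LinearMap.injective_iff_surjective.1 hinj ⟨x, hx⟩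
      have hy' : L y = x := congrArg Subtype.val hy
      rw [← hy', hback]
      exact y.2
    refine ⟨?_, fun x hx => by simpa using hinv x hx, ?_⟩
    · have : ((g⁻¹ : (TruncTensor V m)ˣ) : TruncTensor V m) - 1 =
          -((g⁻¹ : (TruncTensor V m)ˣ) * ((g : TruncTensor V m) - 1)) := by
        simp [mul_sub]
      rw [this]
      exact neg_mem (degFilt_mul_left hg1 _)
    · have h0 : degDer V m ((g : TruncTensor V m) * (g⁻¹ : (TruncTensor V m)ˣ)) = 0 := by
        rw [Units.mul_inv, degDer_one]
      rw [degDer_mul] at h0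
      have h1 : degDer V m (g⁻¹ : (TruncTensor V m)ˣ) * (g⁻¹⁻¹ : (TruncTensor V m)ˣ) =
          -((g⁻¹ : (TruncTensor V m)ˣ) * (degDer V m g * (g⁻¹ : (TruncTensor V m)ˣ)) * g) := by
        have h2 := congrArg (fun x => ((g⁻¹ : (TruncTensor V m)ˣ) : TruncTensor V m) * x * g) h0
        simp only [mul_add, add_mul, mul_zero, zero_mul, ← mul_assoc, Units.inv_mul, one_mul] at h2
        rw [inv_inv, eq_neg_iff_add_eq_zero, add_comm]
        simpa [mul_assoc] using h2
      rw [h1]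
      exact neg_mem (hinv _ hg3)

theorem sub_one_mem_of_mem_lieGroup {g : (TruncTensor V m)ˣ} (hg : g ∈ lieGroup V m) :
    (g : TruncTensor V m) - 1 ∈ degFilt V m 1 := hg.1

/-- The solution of `Z' = Z u`, `Z = 1` initially, stays in `lieGroup V m` if `u` takes its values
in the free nilpotent Lie algebra. -/
theorem exists_mem_lieGroup_of_hasDerivWithinAt {Z u : ℝ → TruncTensor V m} {a b : ℝ}
    (hZ : ∀ r ∈ Set.Icc a b, HasDerivWithinAt Z (Z r * u r) (Set.Icc a b) r)
    (hu : ∀ r ∈ Set.Icc a b, u r ∈ freeNilLieAlgebra V m) (ha : Z a = 1) {t : ℝ}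
    (ht : t ∈ Set.Icc a b) : ∃ g ∈ lieGroup V m, (g : TruncTensor V m) = Z t := by
  rcases (ht.1.trans ht.2).eq_or_lt with hab | hab
  · obtain rfl : t = a := le_antisymm (hab ▸ ht.2) ht.1
    exact ⟨1, one_mem _, by simp [ha]⟩
  have hF : ∀ r ∈ Set.Icc a b, Z r - 1 ∈ degFilt V m 1 := fun r hr =>
    mem_of_hasDerivWithinAt_mem (fun q hq => (hZ q hq).sub_const 1)
      (fun q hq => degFilt_mul_left (freeNilLieAlgebra_le_degFilt (hu q hq)) _)
      (by simp [ha]) hr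
  have hW : ∀ r ∈ Set.Icc a b, HasDerivWithinAt (fun r => nilInv (Z r)) (-(u r * nilInv (Z r)))
      (Set.Icc a b) r := fun r hr =>
    hasDerivWithinAt_nilInv (uniqueDiffOn_Icc hab r hr) hr (hZ r hr) hF
  have ha1 : nilInv (1 : TruncTensor V m) = 1 := by
    simpa using mul_nilInv (g := (1 : TruncTensor V m)) (by simp)
  -- `(Z x Z⁻¹)' = Z [u, x] Z⁻¹`, and bracketing with `u` raises the degree
  have hAd : ∀ k, ∀ x ∈ freeNilLieAlgebra V m, x ∈ degFilt V m (m + 1 - k) →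
      ∀ r ∈ Set.Icc a b, Z r * x * nilInv (Z r) ∈ (freeNilLieAlgebra V m).toSubmodule := by
    intro k
    induction k with
    | zero =>
      intro x _ hx r _
      rw [Nat.sub_zero, degFilt_eq_bot m.lt_succ_self, Submodule.mem_bot] at hx
      simp [hx]
    | succ k ih =>
      intro x hx hxk r hr
      refine mem_of_hasDerivWithinAt_mem (f := fun q => Z q * x * nilInv (Z q))
        (S := (freeNilLieAlgebra V m).toSubmodule)
        (F := fun q => Z q * ⁅u q, x⁆ * nilInv (Z q))
        (fun q hq => ?_) (fun q hq => ?_) (by simpa [ha1, ha] using hx) hr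
      · refine (hasDerivWithinAt_mul (hasDerivWithinAt_mul (hZ q hq)
          (hasDerivWithinAt_const q _ x)) (hW q hq)).congr_deriv ?_
        rw [LieRing.of_associative_ring_bracket]
        noncomm_ring
      · refine ih _ ((freeNilLieAlgebra V m).lie_mem (hu q hq) hx) ?_ q hq
        exact degFilt_anti (by omega)
          (lie_mem_degFilt (freeNilLieAlgebra_le_degFilt (hu q hq)) hxk)
  have hAd' : ∀ x ∈ freeNilLieAlgebra V m, ∀ r ∈ Set.Icc a b,
      Z r * x * nilInv (Z r) ∈ (freeNilLieAlgebra V m).toSubmodule := fun x hx =>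
    hAd (m + 1) x hx (by rw [Nat.sub_self]; exact mem_degFilt_zero x)
  refine ⟨unipUnit (Z t) (hF t ht), ⟨hF t ht, fun x hx => hAd' x hx t ht, ?_⟩, rfl⟩
  refine mem_of_hasDerivWithinAt_mem (f := fun q => degDer V m (Z q) * nilInv (Z q))
    (S := (freeNilLieAlgebra V m).toSubmodule)
    (F := fun q => Z q * degDer V m (u q) * nilInv (Z q))
    (fun q hq => ?_) (fun q hq => ?_) (by simp [ha, degDer_one]) ht
  · refine (hasDerivWithinAt_mul (hasDerivWithinAt_linearMap (degDer V m) (hZ q hq))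
      (hW q hq)).congr_deriv ?_
    rw [degDer_mul]
    noncomm_ring
  · exact hAd' _ (degDer_mem_freeNilLieAlgebra (hu q hq)) q hq

/-- `freeNilGroup V m ⊆ lieGroup V m`: the path `t ↦ exp(t x)` solves `Z' = Z x`. -/
theorem exists_mem_lieGroup_of_mem_freeNilGroup {g : TruncTensor V m}
    (hg : g ∈ freeNilGroup V m) : ∃ h ∈ lieGroup V m, (h : TruncTensor V m) = g := by
  obtain ⟨x, hx, rfl⟩ := hg
  have h := exists_mem_lieGroup_of_hasDerivWithinAt
    (Z := fun t => ∑ k ∈ Finset.range (m + 1), (t ^ k * (k.factorial : ℝ)⁻¹) • x ^ k)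
    (u := fun _ => x) (a := 0) (b := 1) (t := 1) (fun r _ => ?_) (fun _ _ => hx) ?_ (by simp)
  · simpa [texp] using h
  · have hd : HasDerivAt
        (fun t : ℝ => ∑ k ∈ Finset.range (m + 1), (t ^ k * (k.factorial : ℝ)⁻¹) • x ^ k)
        (∑ k ∈ Finset.range (m + 1), ((k * r ^ (k - 1)) * (k.factorial : ℝ)⁻¹) • x ^ k) r :=
      HasDerivAt.fun_sum fun k _ => ((hasDerivAt_pow k r).mul_const _).smul_const _
    refine (hd.congr_deriv ?_).hasDerivWithinAt
    rw [Finset.sum_range_succ', Finset.sum_range_succ, add_mul, smul_mul_assoc, ← pow_succ,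
      pow_eq_zero_of_mem_degFilt (freeNilLieAlgebra_le_degFilt hx) m.lt_succ_self, Finset.sum_mul]
    simp only [Nat.cast_zero, zero_mul, zero_smul, smul_zero]
    congr 1
    refine Finset.sum_congr rfl fun k _ => ?_
    rw [smul_mul_assoc, ← pow_succ, Nat.factorial_succ, Nat.add_sub_cancel]
    congr 1
    push_cast
    field_simp
  · rw [Finset.sum_range_succ']
    simp

/-! ### The differential equation of the signature -/

theorem hasDerivWithinAt_integral {E : Type*} [NormedAddCommGroup E] [NormedSpace ℝ E]
    [CompleteSpace E] {f : ℝ → E} {a b s t : ℝ} (hf : ContinuousOn f (Set.Icc a b))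
    (hs : s ∈ Set.Icc a b) (ht : t ∈ Set.Icc a b) :
    HasDerivWithinAt (fun r => ∫ u in s..r, f u) (f t) (Set.Icc a b) t := by
  have : Fact (t ∈ Set.Icc a b) := ⟨ht⟩
  refine intervalIntegral.integral_hasDerivWithinAt_right (t := Set.Icc a b) ?_ ?_ (hf t ht)
  · exact (hf.mono (Set.uIcc_subset_Icc hs ht)).intervalIntegrable
  · exact hf.stronglyMeasurableAtFilter_nhdsWithin measurableSet_Icc t

instance : CompleteSpace (TruncTensor V m) := FiniteDimensional.complete ℝ _

namespace SmoothPath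

variable (y : SmoothPath V)

omit [FiniteDimensional ℝ V] in
theorem hasDerivWithinAt {r : ℝ} (hr : r ∈ Set.Icc (0 : ℝ) 1) :
    HasDerivWithinAt y.toFun (y.deriv r) (Set.Icc 0 1) r :=
  ((y.smooth.differentiableOn (by simp)) r hr).hasDerivWithinAt

omit [FiniteDimensional ℝ V] in
theorem continuousOn_deriv : ContinuousOn y.deriv (Set.Icc 0 1) :=
  y.smooth.continuousOn_derivWithin (uniqueDiffOn_Icc one_pos) (by simp)

omit [FiniteDimensional ℝ V] in
theorem deriv_eq {a b r : ℝ} {v : V} (h0 : 0 ≤ a) (hab : a < b) (h1 : b ≤ 1)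
    (hr : r ∈ Set.Icc a b) (h : HasDerivWithinAt y.toFun v (Set.Icc a b) r) : y.deriv r = v :=
  (uniqueDiffOn_Icc hab r hr).eq_deriv _
    ((y.hasDerivWithinAt (Set.Icc_subset_Icc h0 h1 hr)).mono (Set.Icc_subset_Icc h0 h1)) h

variable (m) in
/-- The driving term `ι(ẏ)` of the differential equation of the signature. -/
def drive (r : ℝ) : TruncTensor V m := TruncTensor.ι V m (y.deriv r)

theorem continuousOn_drive : ContinuousOn (y.drive m) (Set.Icc 0 1) :=
  (LinearMap.continuous_of_finiteDimensional (TruncTensor.ι V m)).comp_continuousOn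
    y.continuousOn_deriv

theorem continuousOn_iterInt {s : ℝ} (hs : s ∈ Set.Icc (0 : ℝ) 1) (k : ℕ) :
    ContinuousOn (y.iterInt m k s) (Set.Icc 0 1) := by
  induction k with
  | zero => exact continuousOn_const
  | succ k ih =>
    exact fun t ht => (hasDerivWithinAt_integral (ih.mul y.continuousOn_drive) hs
      ht).continuousWithinAt

theorem hasDerivWithinAt_iterInt {s t : ℝ} (hs : s ∈ Set.Icc (0 : ℝ) 1)
    (ht : t ∈ Set.Icc (0 : ℝ) 1) (k : ℕ) :
    HasDerivWithinAt (y.iterInt m (k + 1) s) (y.iterInt m k s t * y.drive m t) (Set.Icc 0 1) t :=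
  hasDerivWithinAt_integral ((y.continuousOn_iterInt hs k).mul y.continuousOn_drive) hs ht

theorem iterInt_mem_degFilt {s t : ℝ} (hs : s ∈ Set.Icc (0 : ℝ) 1)
    (ht : t ∈ Set.Icc (0 : ℝ) 1) (k : ℕ) : y.iterInt m k s t ∈ degFilt V m k := by
  induction k generalizing t with
  | zero => exact mem_degFilt_zero _
  | succ k ih =>
    have hsub : Set.uIcc s t ⊆ Set.Icc 0 1 := Set.uIcc_subset_Icc hs ht
    exact intervalIntegral_mem
      (((y.continuousOn_iterInt hs k).mul y.continuousOn_drive).mono hsub).intervalIntegrable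
      fun r hr => mul_mem_degFilt (ih (hsub hr)) (ι_mem_degFilt_one _)

theorem iterInt_eq_zero {s t : ℝ} (hs : s ∈ Set.Icc (0 : ℝ) 1)
    (ht : t ∈ Set.Icc (0 : ℝ) 1) {k : ℕ} (hk : m < k) : y.iterInt m k s t = 0 := by
  simpa [degFilt_eq_bot hk] using y.iterInt_mem_degFilt (m := m) hs ht k

theorem iterInt_succ_self (k : ℕ) (s : ℝ) : y.iterInt m (k + 1) s s = 0 := by
  simp [iterInt]

theorem sig_self (s : ℝ) : y.sig m s s = 1 := by
  rw [sig, Finset.sum_range_succ', Finset.sum_eq_zero fun k _ => y.iterInt_succ_self k s, zero_add]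
  rfl

theorem hasDerivWithinAt_sig {s t : ℝ} (hs : s ∈ Set.Icc (0 : ℝ) 1)
    (ht : t ∈ Set.Icc (0 : ℝ) 1) :
    HasDerivWithinAt (y.sig m s) (y.sig m s t * y.drive m t) (Set.Icc 0 1) t := by
  have h : HasDerivWithinAt (fun t => ∑ k ∈ Finset.range m, y.iterInt m (k + 1) s t + 1)
      (∑ k ∈ Finset.range m, y.iterInt m k s t * y.drive m t) (Set.Icc 0 1) t :=
    (HasDerivWithinAt.fun_sum fun k _ => y.hasDerivWithinAt_iterInt hs ht k).add_const 1
  have h2 : y.sig m s = fun t => ∑ k ∈ Finset.range m, y.iterInt m (k + 1) s t + 1 := by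
    funext t
    rw [sig, Finset.sum_range_succ']
    rfl
  rw [h2]
  refine h.congr_deriv ?_
  have h3 : y.iterInt m m s t * y.drive m t = 0 := by
    have := mul_mem_degFilt (y.iterInt_mem_degFilt (m := m) hs ht m)
      (ι_mem_degFilt_one (m := m) (y.deriv t))
    rwa [degFilt_eq_bot m.lt_succ_self, Submodule.mem_bot] at this
  have h4 : y.sig m s t * y.drive m t =
      ∑ k ∈ Finset.range m, y.iterInt m k s t * y.drive m t := by
    rw [sig, Finset.sum_range_succ, add_mul, h3, add_zero, Finset.sum_mul]
  rw [← h4, h2]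

end SmoothPath

/-- Uniqueness for the linear equation `Z' = Z u`. -/
theorem eqOn_of_hasDerivWithinAt_mul {Z₁ Z₂ u : ℝ → TruncTensor V m} {a b : ℝ}
    (hu : ContinuousOn u (Set.Icc a b))
    (h₁ : ∀ r ∈ Set.Icc a b, HasDerivWithinAt Z₁ (Z₁ r * u r) (Set.Icc a b) r)
    (h₂ : ∀ r ∈ Set.Icc a b, HasDerivWithinAt Z₂ (Z₂ r * u r) (Set.Icc a b) r)
    (ha : Z₁ a = Z₂ a) : Set.EqOn Z₁ Z₂ (Set.Icc a b) := by
  obtain ⟨C, hC⟩ := isCompact_Icc.exists_bound_of_continuousOn hu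
  have hright : ∀ {Z : ℝ → TruncTensor V m},
      (∀ r ∈ Set.Icc a b, HasDerivWithinAt Z (Z r * u r) (Set.Icc a b) r) →
      ∀ r ∈ Set.Ico a b, HasDerivWithinAt Z (Z r * u r) (Set.Ici r) r := fun h r hr =>
    ((h r (Set.Ico_subset_Icc_self hr)).mono (Set.Icc_subset_Icc_left hr.1)).mono_of_mem_nhdsWithin
      (Icc_mem_nhdsGE hr.2)
  refine ODE_solution_unique_of_mem_Icc_right (v := fun r z => z * u r)
    (s := fun _ => Set.univ) (K := (‖mulCLM V m‖ * C).toNNReal) (fun r hr => ?_)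
    (fun r hr => (h₁ r hr).continuousWithinAt) (hright h₁) (fun _ _ => trivial)
    (fun r hr => (h₂ r hr).continuousWithinAt) (hright h₂) (fun _ _ => trivial) ha
  refine LipschitzOnWith.of_dist_le_mul fun x _ z _ => ?_
  rw [dist_eq_norm, dist_eq_norm, ← sub_mul]
  have h1 := hC r (Set.Ico_subset_Icc_self hr)
  have h2 : 0 ≤ ‖mulCLM V m‖ * C :=
    mul_nonneg (mulCLM V m).opNorm_nonneg ((norm_nonneg _).trans h1)
  rw [Real.coe_toNNReal _ h2]
  calc ‖(x - z) * u r‖ ≤ ‖mulCLM V m‖ * ‖x - z‖ * ‖u r‖ := norm_mul_le_mulCLM _ _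
    _ ≤ ‖mulCLM V m‖ * ‖x - z‖ * C := by gcongr
    _ = ‖mulCLM V m‖ * C * ‖x - z‖ := by ring

namespace SmoothPath

variable (y : SmoothPath V)

theorem exists_mem_lieGroup_sig {s t : ℝ} (h0 : 0 ≤ s) (hst : s ≤ t) (h1 : t ≤ 1) :
    ∃ g ∈ lieGroup V m, (g : TruncTensor V m) = y.sig m s t :=
  exists_mem_lieGroup_of_hasDerivWithinAt (u := y.drive m)
    (fun _ hr => (y.hasDerivWithinAt_sig ⟨h0, hst.trans h1⟩
      (Set.Icc_subset_Icc h0 h1 hr)).mono (Set.Icc_subset_Icc h0 h1))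
    (fun _ _ => ι_mem_freeNilLieAlgebra _) (y.sig_self s) ⟨hst, le_rfl⟩

/-! ### Change of parameter -/

section Reparam

variable {y} {z : SmoothPath V} {φ φ' : ℝ → ℝ} {a b : ℝ} {c : V}

omit [FiniteDimensional ℝ V] in
theorem deriv_of_eq_comp (h0 : 0 ≤ a) (hab : a < b) (h1 : b ≤ 1)
    (hφ : ∀ r ∈ Set.Icc a b, HasDerivWithinAt φ (φ' r) (Set.Icc a b) r)
    (hmaps : Set.MapsTo φ (Set.Icc a b) (Set.Icc 0 1))
    (hz : ∀ r ∈ Set.Icc a b, z.toFun r = y.toFun (φ r) + c) {r : ℝ} (hr : r ∈ Set.Icc a b) :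
    z.deriv r = φ' r • y.deriv (φ r) := by
  refine z.deriv_eq h0 hab h1 hr ?_
  exact (((y.hasDerivWithinAt (hmaps hr)).scomp r (hφ r hr) hmaps).add_const c).congr
    (fun q hq => hz q hq) (hz r hr)

/-- If `z = y ∘ φ + c` on `[a,b]`, the signature of `z` over `[a,b]` is the increment of that of
`y` between `φ a` and `φ b`. The change of parameter `φ` need not be monotone. -/
theorem sig_of_eq_comp (h0 : 0 ≤ a) (hab : a < b) (h1 : b ≤ 1)
    (hφ : ∀ r ∈ Set.Icc a b, HasDerivWithinAt φ (φ' r) (Set.Icc a b) r)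
    (hmaps : Set.MapsTo φ (Set.Icc a b) (Set.Icc 0 1))
    (hz : ∀ r ∈ Set.Icc a b, z.toFun r = y.toFun (φ r) + c) :
    y.sig m 0 (φ b) = y.sig m 0 (φ a) * z.sig m a b := by
  have hsub : Set.Icc a b ⊆ Set.Icc 0 1 := Set.Icc_subset_Icc h0 h1
  refine eqOn_of_hasDerivWithinAt_mul (Z₁ := fun r => y.sig m 0 (φ r))
    (Z₂ := fun r => y.sig m 0 (φ a) * z.sig m a r) (u := z.drive m)
    (z.continuousOn_drive.mono hsub) (fun r hr => ?_) (fun r hr => ?_)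
    (by simp [z.sig_self]) ⟨hab.le, le_rfl⟩
  · refine ((y.hasDerivWithinAt_sig (m := m) ⟨le_rfl, zero_le_one⟩ (hmaps hr)).scomp r (hφ r hr)
      hmaps).congr_deriv ?_
    rw [drive, drive, deriv_of_eq_comp h0 hab h1 hφ hmaps hz hr, map_smul, mul_smul_comm]
  · refine (hasDerivWithinAt_mul (hasDerivWithinAt_const r _ _)
      ((z.hasDerivWithinAt_sig (m := m) ⟨h0, hab.le.trans h1⟩ (hsub hr)).mono hsub)).congr_deriv ?_
    rw [zero_mul, add_zero, mul_assoc]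

end Reparam

/-- Chen's identity. -/
theorem sig_zero_mul_sig {s t : ℝ} (h0 : 0 ≤ s) (hst : s ≤ t) (h1 : t ≤ 1) :
    y.sig m 0 s * y.sig m s t = y.sig m 0 t := by
  rcases hst.eq_or_lt with rfl | hlt
  · rw [sig_self, mul_one]
  · exact (sig_of_eq_comp (y := y) (z := y) (c := 0) h0 hlt h1
      (fun r _ => hasDerivWithinAt_id r _) (Set.Icc_subset_Icc h0 h1) (by simp)).symm

theorem incr_sigPath {s t : ℝ} (h0 : 0 ≤ s) (hst : s ≤ t) (h1 : t ≤ 1) :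
    incr (y.sigPath m) s t = y.sig m s t := by
  obtain ⟨g, -, hg⟩ := y.exists_mem_lieGroup_sig (m := m) le_rfl h0 (hst.trans h1)
  rw [incr, sigPath, sigPath, ← y.sig_zero_mul_sig h0 hst h1, ← hg, Ring.inverse_unit,
    Units.inv_mul_cancel_left]

/-! ### Lengths -/

omit [FiniteDimensional ℝ V] in
theorem intervalIntegrable_norm_deriv {s t : ℝ} (hs : s ∈ Set.Icc (0 : ℝ) 1)
    (ht : t ∈ Set.Icc (0 : ℝ) 1) :
    IntervalIntegrable (fun r => ‖y.deriv r‖) MeasureTheory.volume s t :=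
  (y.continuousOn_deriv.norm.mono (Set.uIcc_subset_Icc hs ht)).intervalIntegrable

omit [FiniteDimensional ℝ V] in
theorem length_eq {s t : ℝ} (h0 : 0 ≤ s) (hst : s ≤ t) (h1 : t ≤ 1) :
    y.length s t = ENNReal.ofReal (∫ r in s..t, ‖y.deriv r‖) := by
  have hc := (y.continuousOn_deriv.mono (Set.Icc_subset_Icc h0 h1))
  rw [length, intervalIntegral.integral_of_le hst, ← MeasureTheory.integral_Icc_eq_integral_Ioc,
    MeasureTheory.ofReal_integral_norm_eq_lintegral_enorm (hc.integrableOn_Icc)]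

omit [FiniteDimensional ℝ V] in
theorem length_add {s t u : ℝ} (h0 : 0 ≤ s) (hst : s ≤ t) (htu : t ≤ u) (h1 : u ≤ 1) :
    y.length s t + y.length t u = y.length s u := by
  have hs : s ∈ Set.Icc (0 : ℝ) 1 := ⟨h0, by linarith⟩
  have ht : t ∈ Set.Icc (0 : ℝ) 1 := ⟨by linarith, by linarith⟩
  have hu : u ∈ Set.Icc (0 : ℝ) 1 := ⟨by linarith, h1⟩
  rw [y.length_eq h0 hst ht.2, y.length_eq ht.1 htu h1, y.length_eq h0 (hst.trans htu) h1,
    ← ENNReal.ofReal_add, intervalIntegral.integral_add_adjacent_intervals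
      (y.intervalIntegrable_norm_deriv hs ht) (y.intervalIntegrable_norm_deriv ht hu)]
  · exact intervalIntegral.integral_nonneg hst fun _ _ => norm_nonneg _
  · exact intervalIntegral.integral_nonneg htu fun _ _ => norm_nonneg _

omit [FiniteDimensional ℝ V] in
theorem length_mono {s s' t t' : ℝ} (hs : s' ≤ s) (ht : t ≤ t') :
    y.length s t ≤ y.length s' t' :=
  MeasureTheory.lintegral_mono_set (Set.Icc_subset_Icc hs ht)

omit [FiniteDimensional ℝ V] in
theorem length_eq_zero_of_le {s t : ℝ} (h : t ≤ s) : y.length s t = 0 := by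
  refine MeasureTheory.setLIntegral_measure_zero _ _ ?_
  rw [Real.volume_Icc]
  simpa using h

omit [FiniteDimensional ℝ V] in
/-- The length after a change of parameter `φ` that is monotone (`σ = 1`) or antitone
(`σ = -1`). -/
theorem length_of_eq_comp {y z : SmoothPath V} {φ φ' : ℝ → ℝ} {a b σ : ℝ} {c : V} (h0 : 0 ≤ a)
    (hab : a < b) (h1 : b ≤ 1) (hφ : ∀ r ∈ Set.Icc a b, HasDerivWithinAt φ (φ' r) (Set.Icc a b) r)
    (hφ' : ContinuousOn φ' (Set.Icc a b)) (hσ : ∀ r ∈ Set.Icc a b, |φ' r| = σ * φ' r)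
    (hmaps : Set.MapsTo φ (Set.Icc a b) (Set.Icc 0 1))
    (hz : ∀ r ∈ Set.Icc a b, z.toFun r = y.toFun (φ r) + c) :
    z.length a b = ENNReal.ofReal (σ * ∫ r in φ a..φ b, ‖y.deriv r‖) := by
  rw [z.length_eq h0 hab.le h1]
  congr 1
  have h := intervalIntegral.integral_comp_mul_deriv'' (a := a) (b := b) (f := φ) (f' := φ')
    (g := fun r => ‖y.deriv r‖)
    (by rw [Set.uIcc_of_le hab.le]; exact fun r hr => (hφ r hr).continuousWithinAt)
    (fun r hr => by
      rw [min_eq_left hab.le, max_eq_right hab.le] at hr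
      exact ((hφ r (Set.Ioo_subset_Icc_self hr)).hasDerivAt
        (Icc_mem_nhds hr.1 hr.2)).hasDerivWithinAt)
    (by rwa [Set.uIcc_of_le hab.le])
    (by rw [Set.uIcc_of_le hab.le]; exact y.continuousOn_deriv.norm.mono hmaps.image_subset)
  rw [← h, ← intervalIntegral.integral_const_mul]
  refine intervalIntegral.integral_congr fun r hr => ?_
  rw [Set.uIcc_of_le hab.le] at hr
  simp only [Function.comp]
  rw [deriv_of_eq_comp h0 hab h1 hφ hmaps hz hr, norm_smul, Real.norm_eq_abs, hσ r hr]
  ring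

/-! ### Restriction, reversal, segments -/

/-- The smooth path `y ∘ φ`, translated to start at `0`. -/
def reparam (φ : ℝ → ℝ) (hφ : ContDiff ℝ ∞ φ)
    (hmaps : Set.MapsTo φ (Set.Icc 0 1) (Set.Icc 0 1)) : SmoothPath V where
  toFun r := y.toFun (φ r) - y.toFun (φ 0)
  smooth := (y.smooth.comp hφ.contDiffOn hmaps).sub contDiffOn_const
  zero := sub_self _

theorem exists_restrict {s t : ℝ} (h0 : 0 ≤ s) (hst : s ≤ t) (h1 : t ≤ 1) :
    ∃ z : SmoothPath V, z.sig m 0 1 = y.sig m s t ∧ z.length 0 1 = y.length s t := by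
  have hmaps : Set.MapsTo (fun r : ℝ => s + r * (t - s)) (Set.Icc 0 1) (Set.Icc 0 1) := by
    rintro r ⟨hr0, hr1⟩
    constructor <;> nlinarith
  let z := y.reparam (fun r => s + r * (t - s)) (by fun_prop) hmaps
  have hd : ∀ r ∈ Set.Icc (0 : ℝ) 1,
      HasDerivWithinAt (fun r : ℝ => s + r * (t - s)) (t - s) (Set.Icc 0 1) r := fun r _ => by
    simpa using (((hasDerivAt_id r).mul_const (t - s)).const_add s).hasDerivWithinAt
  have hz : ∀ r ∈ Set.Icc (0 : ℝ) 1,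
      z.toFun r = y.toFun (s + r * (t - s)) + -y.toFun (s + 0 * (t - s)) := fun r _ =>
    sub_eq_add_neg _ _
  refine ⟨z, ?_, ?_⟩
  · have h := sig_of_eq_comp (m := m) le_rfl one_pos le_rfl hd hmaps hz
    simp only [zero_mul, add_zero, one_mul, add_sub_cancel] at h
    rw [← y.sig_zero_mul_sig h0 hst h1] at h
    obtain ⟨g, -, hg⟩ := y.exists_mem_lieGroup_sig (m := m) le_rfl h0 (hst.trans h1)
    rw [← hg, Units.mul_right_inj] at h
    exact h.symm
  · have h := length_of_eq_comp (σ := 1) le_rfl one_pos le_rfl hd continuousOn_const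
      (fun r _ => by rw [one_mul, abs_of_nonneg (by linarith)]) hmaps hz
    simp only [zero_mul, add_zero, one_mul, add_sub_cancel] at h
    rw [h, y.length_eq h0 hst h1]

theorem exists_reverse :
    ∃ z : SmoothPath V, y.sig m 0 1 * z.sig m 0 1 = 1 ∧ z.length 0 1 = y.length 0 1 := by
  have hmaps : Set.MapsTo (fun r : ℝ => 1 - r) (Set.Icc 0 1) (Set.Icc 0 1) := by
    rintro r ⟨hr0, hr1⟩
    constructor <;> linarith
  let z := y.reparam (fun r => 1 - r) (by fun_prop) hmaps
  have hd : ∀ r ∈ Set.Icc (0 : ℝ) 1,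
      HasDerivWithinAt (fun r : ℝ => 1 - r) (-1) (Set.Icc 0 1) r := fun r _ =>
    ((hasDerivAt_id r).const_sub 1).hasDerivWithinAt
  have hz : ∀ r ∈ Set.Icc (0 : ℝ) 1, z.toFun r = y.toFun (1 - r) + -y.toFun (1 - 0) := fun r _ =>
    sub_eq_add_neg _ _
  refine ⟨z, ?_, ?_⟩
  · have h := sig_of_eq_comp (m := m) le_rfl one_pos le_rfl hd hmaps hz
    simp only [sub_zero, sub_self, sig_self] at h
    exact h.symm
  · have h := length_of_eq_comp (σ := -1) le_rfl one_pos le_rfl hd continuousOn_const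
      (fun r _ => by norm_num) hmaps hz
    simp only [sub_zero, sub_self] at h
    rw [h, y.length_eq le_rfl zero_le_one le_rfl, intervalIntegral.integral_symm]
    ring_nf

/-- The segment from `0` to `v`. -/
def segment (v : V) : SmoothPath V where
  toFun r := r • v
  smooth := by fun_prop
  zero := zero_smul _ _

omit [FiniteDimensional ℝ V] in
theorem segment_deriv (v : V) {r : ℝ} (hr : r ∈ Set.Icc (0 : ℝ) 1) :
    (segment v).deriv r = v := by
  refine (segment v).deriv_eq le_rfl one_pos le_rfl hr ?_
  simpa [segment] using ((hasDerivAt_id r).smul_const v).hasDerivWithinAt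

omit [FiniteDimensional ℝ V] in
theorem segment_length (v : V) : (segment v).length 0 1 = ENNReal.ofReal ‖v‖ := by
  rw [length_eq _ le_rfl zero_le_one le_rfl]
  congr 1
  rw [intervalIntegral.integral_congr (g := fun _ => ‖v‖) fun r hr => ?_]
  · simp
  · rw [Set.uIcc_of_le zero_le_one] at hr
    simp only [segment_deriv v hr]

theorem segment_sig (v : V) :
    (segment v).sig m 0 1 - 1 - TruncTensor.ι V m v ∈ degFilt V m 2 := by
  have h0 : (0 : ℝ) ∈ Set.Icc (0 : ℝ) 1 := ⟨le_rfl, zero_le_one⟩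
  have h1 : (1 : ℝ) ∈ Set.Icc (0 : ℝ) 1 := ⟨zero_le_one, le_rfl⟩
  have hι : (segment v).iterInt m 1 0 1 = TruncTensor.ι V m v := by
    simp only [iterInt, one_mul]
    rw [intervalIntegral.integral_congr (g := fun _ => TruncTensor.ι V m v) fun r hr => ?_]
    · simp
    · rw [Set.uIcc_of_le zero_le_one] at hr
      simp only [segment_deriv v hr]
  have hs : (segment v).sig m 0 1 = ∑ k ∈ Finset.range m, (segment v).iterInt m (k + 2) 0 1 +
      TruncTensor.ι V m v + 1 := by
    have h2 := Finset.sum_range_succ (fun k => (segment v).iterInt m k 0 1) (m + 1)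
    rw [iterInt_eq_zero _ h0 h1 m.lt_succ_self, add_zero] at h2
    rw [sig, ← h2, Finset.sum_range_succ', Finset.sum_range_succ', zero_add, hι]
    rfl
  rw [hs, add_sub_cancel_right, add_sub_cancel_right]
  exact sum_mem fun k _ => degFilt_anti (by omega) (iterInt_mem_degFilt _ h0 h1 _)

end SmoothPath

/-! ### Subdivisions and concatenation -/

namespace Subdivision

variable (D : Subdivision)

theorem lt_succ (i : Fin D.n) : D.t i.castSucc < D.t i.succ :=
  D.strictMono Fin.castSucc_lt_succ

theorem nonneg (i : Fin (D.n + 1)) : 0 ≤ D.t i :=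
  D.t_zero ▸ D.strictMono.monotone (Fin.zero_le i)

theorem le_one (i : Fin (D.n + 1)) : D.t i ≤ 1 :=
  D.t_last ▸ D.strictMono.monotone (Fin.le_last i)

/-- The subdivision of `[0,1]` into `n + 1` intervals of equal length. -/
def uniform (n : ℕ) : Subdivision where
  n := n + 1
  t i := (i : ℝ) / (n + 1)
  strictMono i j hij := by
    have : ((i : ℕ) : ℝ) < ((j : ℕ) : ℝ) := by exact_mod_cast hij
    simp only
    gcongr
  t_zero := by simp
  t_last := by
    simp only [Fin.val_last]
    push_cast
    exact div_self (by positivity)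

end Subdivision

/-- The smooth paths `y i`, each traversed at a speed vanishing to infinite order at the two ends,
can be concatenated along a subdivision. -/
theorem SmoothPath.exists_concat (D : Subdivision) (y : Fin D.n → SmoothPath V) :
    ∃ z : SmoothPath V, ∀ i,
      (∀ m, z.sig m (D.t i.castSucc) (D.t i.succ) = (y i).sig m 0 1) ∧
      z.length (D.t i.castSucc) (D.t i.succ) = (y i).length 0 1 := by
  let φ : Fin D.n → ℝ → ℝ := fun i r =>
    Real.smoothTransition ((r - D.t i.castSucc) / (D.t i.succ - D.t i.castSucc))
  have hφ : ∀ i, ContDiff ℝ ∞ (φ i) := fun i =>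
    Real.smoothTransition.contDiff.comp (by fun_prop)
  have hmaps : ∀ i s, Set.MapsTo (φ i) s (Set.Icc 0 1) := fun i s r _ =>
    ⟨Real.smoothTransition.nonneg _, Real.smoothTransition.le_one _⟩
  have hpos : ∀ i : Fin D.n, 0 < D.t i.succ - D.t i.castSucc := fun i =>
    sub_pos.2 (D.lt_succ i)
  have hφ0 : ∀ i r, r ≤ D.t i.castSucc → φ i r = 0 := fun i r hr =>
    Real.smoothTransition.zero_of_nonpos
      (div_nonpos_of_nonpos_of_nonneg (by linarith) (hpos i).le)
  have hφ1 : ∀ i r, D.t i.succ ≤ r → φ i r = 1 := fun i r hr =>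
    Real.smoothTransition.one_of_one_le ((one_le_div (hpos i)).2 (by linarith))
  let z : SmoothPath V :=
    { toFun := fun r => ∑ i, (y i).toFun (φ i r)
      smooth := ContDiffOn.sum fun i _ => (y i).smooth.comp (hφ i).contDiffOn (hmaps i _)
      zero := Finset.sum_eq_zero fun i _ => by rw [hφ0 i 0 (D.nonneg _), (y i).zero] }
  refine ⟨z, fun i => ?_⟩
  have hd : ∀ r ∈ Set.Icc (D.t i.castSucc) (D.t i.succ),
      HasDerivWithinAt (φ i) (_root_.deriv (φ i) r) (Set.Icc (D.t i.castSucc) (D.t i.succ)) r :=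
    fun r _ => (((hφ i).differentiable (by simp)) r).hasDerivAt.hasDerivWithinAt
  -- on the `i`-th interval the other summands are constant
  have hz : ∀ r ∈ Set.Icc (D.t i.castSucc) (D.t i.succ), z.toFun r = (y i).toFun (φ i r) +
      ∑ j ∈ Finset.univ.erase i, if j < i then (y j).toFun 1 else 0 := by
    intro r hr
    change ∑ j, (y j).toFun (φ j r) = _
    rw [← Finset.add_sum_erase _ _ (Finset.mem_univ i)]
    congr 1
    refine Finset.sum_congr rfl fun j hj => ?_
    split_ifs with hji
    · rw [hφ1 j r ((D.strictMono.monotone _).trans hr.1)]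
      exact Fin.succ_le_castSucc_iff.2 hji
    · have hij : i < j := lt_of_le_of_ne (not_lt.1 hji) (Finset.ne_of_mem_erase hj).symm
      rw [hφ0 j r (hr.2.trans (D.strictMono.monotone _)), (y j).zero]
      exact Fin.succ_le_castSucc_iff.2 hij
  have e0 : φ i (D.t i.castSucc) = 0 := hφ0 i _ le_rfl
  have e1 : φ i (D.t i.succ) = 1 := hφ1 i _ le_rfl
  constructor
  · intro m
    have h := SmoothPath.sig_of_eq_comp (m := m) (D.nonneg _) (D.lt_succ i) (D.le_one _) hd
      (hmaps i _) hz
    rw [e0, e1, SmoothPath.sig_self, one_mul] at h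
    exact h.symm
  · have h := SmoothPath.length_of_eq_comp (σ := 1) (D.nonneg _) (D.lt_succ i) (D.le_one _) hd
      ((hφ i).continuous_deriv (by simp)).continuousOn (fun r _ => ?_) (hmaps i _) hz
    · rw [e0, e1, one_mul] at h
      rw [h, SmoothPath.length_eq _ le_rfl zero_le_one le_rfl]
    · rw [one_mul, abs_of_nonneg]
      refine Monotone.deriv_nonneg ?_
      exact Real.smoothTransition.monotone.comp fun a b hab =>
        div_le_div_of_nonneg_right (by linarith) (hpos i).le

/-! ### The Carnot–Carathéodory norm -/

theorem ccNorm_lt_iff {g : TruncTensor V m} {c : ℝ≥0∞} :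
    ccNorm m g < c ↔ ∃ y : SmoothPath V, y.sig m 0 1 = g ∧ y.length 0 1 < c := by
  simp [ccNorm, iInf_lt_iff]

theorem ccNorm_sig_le (y : SmoothPath V) {s t : ℝ} (h0 : 0 ≤ s) (hst : s ≤ t) (h1 : t ≤ 1) :
    ccNorm m (y.sig m s t) ≤ y.length s t := by
  obtain ⟨z, hz, hl⟩ := y.exists_restrict (m := m) h0 hst h1
  rw [← hl]
  exact iInf₂_le z hz

theorem ccNorm_one : ccNorm m (1 : TruncTensor V m) = 0 := by
  have h := ccNorm_sig_le (m := m) (SmoothPath.segment (0 : V)) le_rfl le_rfl zero_le_one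
  rw [SmoothPath.sig_self, SmoothPath.length_eq_zero_of_le _ le_rfl] at h
  exact le_antisymm h zero_le

theorem ccNorm_mul_le (g h : TruncTensor V m) : ccNorm m (g * h) ≤ ccNorm m g + ccNorm m h := by
  have key : ∀ y z : SmoothPath V, y.sig m 0 1 = g → z.sig m 0 1 = h →
      ccNorm m (g * h) ≤ y.length 0 1 + z.length 0 1 := by
    rintro y z rfl rfl
    let D := Subdivision.uniform 1
    obtain ⟨x, hx⟩ := SmoothPath.exists_concat D (![y, z] : Fin 2 → SmoothPath V)
    have t0 : D.t (Fin.castSucc (0 : Fin 2)) = 0 := by simp [D, Subdivision.uniform]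
    have t1 : D.t (Fin.succ (0 : Fin 2)) = 2⁻¹ := by simp [D, Subdivision.uniform]; norm_num
    have t1' : D.t (Fin.castSucc (1 : Fin 2)) = 2⁻¹ := by
      simp [D, Subdivision.uniform]; norm_num
    have t2 : D.t (Fin.succ (1 : Fin 2)) = 1 := by simp [D, Subdivision.uniform]; norm_num
    obtain ⟨hs0, hl0⟩ := hx (0 : Fin 2)
    obtain ⟨hs1, hl1⟩ := hx (1 : Fin 2)
    simp only [t0, t1, t1', t2, Matrix.cons_val_zero, Matrix.cons_val_one] at hs0 hl0 hs1 hl1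
    rw [← hs0, ← hs1, ← hl0, ← hl1,
      x.sig_zero_mul_sig (by norm_num) (by norm_num) le_rfl,
      x.length_add le_rfl (by norm_num) (by norm_num) le_rfl]
    exact ccNorm_sig_le x le_rfl zero_le_one le_rfl
  have h2 : ccNorm m g + ccNorm m h =
      ⨅ (z : SmoothPath V) (_ : z.sig m 0 1 = h) (y : SmoothPath V) (_ : y.sig m 0 1 = g),
        (y.length 0 1 + z.length 0 1) := by
    simp only [ccNorm, ENNReal.iInf_add, ENNReal.add_iInf]
  rw [h2]
  exact le_iInf₂ fun z hz => le_iInf₂ fun y hy => key y z hy hz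

theorem ccNorm_inv_le (g : (TruncTensor V m)ˣ) :
    ccNorm m ((g⁻¹ : (TruncTensor V m)ˣ) : TruncTensor V m) ≤ ccNorm m (g : TruncTensor V m) := by
  refine le_iInf₂ fun y hy => ?_
  obtain ⟨z, hz, hl⟩ := y.exists_reverse (m := m)
  rw [hy] at hz
  rw [Units.inv_eq_of_mul_eq_one_right hz, ← hl]
  exact ccNorm_sig_le z le_rfl zero_le_one le_rfl

theorem ccNorm_inv (g : (TruncTensor V m)ˣ) :
    ccNorm m ((g⁻¹ : (TruncTensor V m)ˣ) : TruncTensor V m) = ccNorm m (g : TruncTensor V m) :=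
  le_antisymm (ccNorm_inv_le g) (by simpa using ccNorm_inv_le g⁻¹)

/-- The iterated integrals of a path of length `ℓ` are `O(ℓ ^ k)`. -/
theorem exists_norm_iterInt_le (V : Type*) [NormedAddCommGroup V] [NormedSpace ℝ V]
    [FiniteDimensional ℝ V] (m : ℕ) : ∃ C : ℝ, 0 ≤ C ∧ ∀ (y : SmoothPath V) (k : ℕ),
      ∀ t ∈ Set.Icc (0 : ℝ) 1, ‖y.iterInt m k 0 t‖ ≤
        ‖(1 : TruncTensor V m)‖ * (C * ∫ r in (0 : ℝ)..1, ‖y.deriv r‖) ^ k := by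
  let ι' := LinearMap.toContinuousLinearMap (TruncTensor.ι V m)
  have hC : 0 ≤ ‖mulCLM V m‖ * ‖ι'‖ := mul_nonneg (mulCLM V m).opNorm_nonneg (norm_nonneg _)
  refine ⟨‖mulCLM V m‖ * ‖ι'‖, hC, fun y k => ?_⟩
  set C := ‖mulCLM V m‖ * ‖ι'‖
  set ℓ := ∫ r in (0 : ℝ)..1, ‖y.deriv r‖
  have hℓ0 : 0 ≤ ℓ := intervalIntegral.integral_nonneg zero_le_one fun _ _ => norm_nonneg _
  induction k with
  | zero => intro t _; simp [SmoothPath.iterInt]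
  | succ k ih =>
    intro t ht
    set B := ‖(1 : TruncTensor V m)‖ * (C * ℓ) ^ k
    have hB : 0 ≤ B := by positivity
    have h0 : (0 : ℝ) ∈ Set.Icc (0 : ℝ) 1 := ⟨le_rfl, zero_le_one⟩
    calc ‖y.iterInt m (k + 1) 0 t‖ ≤ ∫ r in (0 : ℝ)..t, C * B * ‖y.deriv r‖ := by
          refine intervalIntegral.norm_integral_le_of_norm_le ht.1
            (.of_forall fun r hr => ?_)
            ((y.intervalIntegrable_norm_deriv h0 ht).const_mul _)
          have hr' : r ∈ Set.Icc (0 : ℝ) 1 := ⟨hr.1.le, hr.2.trans ht.2⟩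
          calc ‖y.iterInt m k 0 r * TruncTensor.ι V m (y.deriv r)‖
              ≤ ‖mulCLM V m‖ * ‖y.iterInt m k 0 r‖ * ‖ι' (y.deriv r)‖ :=
                norm_mul_le_mulCLM _ _
            _ ≤ ‖mulCLM V m‖ * B * (‖ι'‖ * ‖y.deriv r‖) := by
                have := (mulCLM V m).opNorm_nonneg
                gcongr
                · exact ih r hr'
                · exact ι'.le_opNorm _
            _ = C * B * ‖y.deriv r‖ := by simp only [C]; ring
      _ = C * B * ∫ r in (0 : ℝ)..t, ‖y.deriv r‖ := intervalIntegral.integral_const_mul _ _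
      _ ≤ C * B * ℓ := by
          refine mul_le_mul_of_nonneg_left ?_ (mul_nonneg hC hB)
          exact intervalIntegral.integral_mono_interval le_rfl ht.1 ht.2
            (.of_forall fun _ => norm_nonneg _)
            (y.intervalIntegrable_norm_deriv h0 ⟨zero_le_one, le_rfl⟩)
      _ = ‖(1 : TruncTensor V m)‖ * (C * ℓ) ^ (k + 1) := by simp only [B]; ring

/-- Elements of small Carnot–Carathéodory norm are close to `1`. -/
theorem exists_forall_ccNorm_lt_mem {U : Set (TruncTensor V m)} (hU : U ∈ 𝓝 1) :
    ∃ η : ℝ≥0∞, 0 < η ∧ ∀ g : TruncTensor V m, ccNorm m g < η → g ∈ U := by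
  obtain ⟨C, hC, hb⟩ := exists_norm_iterInt_le V m
  obtain ⟨ε, hε, hεU⟩ := Metric.mem_nhds_iff.1 hU
  let P : ℝ → ℝ := fun ℓ => ∑ k ∈ Finset.range m, ‖(1 : TruncTensor V m)‖ * (C * ℓ) ^ (k + 1)
  have hP : Continuous P := by fun_prop
  have hP0 : P 0 = 0 := by simp [P]
  obtain ⟨δ, hδ, hδP⟩ := Metric.continuous_iff.1 hP 0 ε hε
  refine ⟨ENNReal.ofReal δ, by simpa using hδ, fun g hg => hεU ?_⟩
  obtain ⟨y, rfl, hy⟩ := ccNorm_lt_iff.1 hg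
  rw [y.length_eq le_rfl zero_le_one le_rfl, ENNReal.ofReal_lt_ofReal_iff hδ] at hy
  have hℓ0 : 0 ≤ ∫ r in (0 : ℝ)..1, ‖y.deriv r‖ :=
    intervalIntegral.integral_nonneg zero_le_one fun _ _ => norm_nonneg _
  have h1 := hδP _ (by rwa [Real.dist_eq, sub_zero, abs_of_nonneg hℓ0])
  rw [hP0, Real.dist_eq, sub_zero] at h1
  rw [Metric.mem_ball, dist_eq_norm, SmoothPath.sig, Finset.sum_range_succ']
  change ‖_ + 1 - 1‖ < ε
  rw [add_sub_cancel_right]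
  refine (norm_sum_le_of_le _ fun k _ => hb y (k + 1) 1 ⟨zero_le_one, le_rfl⟩).trans_lt ?_
  exact (le_abs_self _).trans_lt h1

/-! ### Chow's theorem -/

/-- `r`, of degree `k + 1`, is the leading term of group elements of small Carnot–Carathéodory
norm: each multiple `c r` is the leading term of an element of norm at most `ρ c`, where `ρ` is
finite and vanishes at `0`. -/
def IsReachable (k : ℕ) (r : TruncTensor V m) : Prop :=
  ∃ ρ : ℝ → ℝ≥0∞, (∀ c, ρ c ≠ ⊤) ∧ Filter.Tendsto ρ (𝓝 0) (𝓝 0) ∧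
    ∀ c : ℝ, ∃ h ∈ lieGroup V m, (h : TruncTensor V m) - 1 - c • r ∈ degFilt V m (k + 2) ∧
      ccNorm m (h : TruncTensor V m) ≤ ρ c

omit [FiniteDimensional ℝ V] in
/-- To leading order, the product of `1 + x` and `1 + y` is `1 + x + y`. -/
theorem mul_sub_one_sub_add_mem {k : ℕ} {g h x y : TruncTensor V m}
    (hx : x ∈ degFilt V m (k + 1)) (hy : y ∈ degFilt V m (k + 1))
    (hg : g - 1 - x ∈ degFilt V m (k + 2)) (hh : h - 1 - y ∈ degFilt V m (k + 2)) :
    g * h - 1 - (x + y) ∈ degFilt V m (k + 2) := by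
  have hg' : g - 1 ∈ degFilt V m (k + 1) := by
    simpa using add_mem (degFilt_anti (by omega) hg) hx
  have hh' : h - 1 ∈ degFilt V m (k + 1) := by
    simpa using add_mem (degFilt_anti (by omega) hh) hy
  have e : g * h - 1 - (x + y) = (g - 1) * (h - 1) + ((g - 1 - x) + (h - 1 - y)) := by
    noncomm_ring
  rw [e]
  exact add_mem (degFilt_anti (by omega) (mul_mem_degFilt hg' hh')) (add_mem hg hh)

theorem isReachable_zero (k : ℕ) : IsReachable k (0 : TruncTensor V m) :=
  ⟨fun _ => 0, by simp, tendsto_const_nhds, fun c => ⟨1, one_mem _, by simp, by simp [ccNorm_one]⟩⟩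

theorem IsReachable.smul {k : ℕ} {r : TruncTensor V m} (hr : IsReachable k r) (a : ℝ) :
    IsReachable k (a • r) := by
  obtain ⟨ρ, hρ, hρ0, h⟩ := hr
  refine ⟨fun c => ρ (c * a), fun c => hρ _, hρ0.comp ?_, fun c => ?_⟩
  · exact (continuous_mul_const a).tendsto' 0 0 (zero_mul a)
  · simpa [mul_smul] using h (c * a)

theorem IsReachable.add {k : ℕ} {r s : TruncTensor V m} (hr : IsReachable k r)
    (hs : IsReachable k s) (hr' : r ∈ lieDeg V m k) (hs' : s ∈ lieDeg V m k) :
    IsReachable k (r + s) := by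
  obtain ⟨ρ, hρ, hρ0, h⟩ := hr
  obtain ⟨ρ', hρ', hρ0', h'⟩ := hs
  refine ⟨fun c => ρ c + ρ' c, fun c => ENNReal.add_ne_top.2 ⟨hρ c, hρ' c⟩,
    by simpa using hρ0.add hρ0', fun c => ?_⟩
  obtain ⟨g, hg, hg1, hg2⟩ := h c
  obtain ⟨g', hg', hg1', hg2'⟩ := h' c
  refine ⟨g * g', mul_mem hg hg', ?_, ?_⟩
  · rw [smul_add, Units.val_mul]
    exact mul_sub_one_sub_add_mem (Submodule.smul_mem _ _ (lieDeg_le_degFilt k hr'))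
      (Submodule.smul_mem _ _ (lieDeg_le_degFilt k hs')) hg1 hg1'
  · rw [Units.val_mul]
    exact (ccNorm_mul_le _ _).trans (add_le_add hg2 hg2')

/-- The group element of the segment from `0` to `v`. -/
theorem exists_mem_lieGroup_segment (v : V) : ∃ h ∈ lieGroup V m,
    (h : TruncTensor V m) - 1 - TruncTensor.ι V m v ∈ degFilt V m 2 ∧
      ccNorm m (h : TruncTensor V m) ≤ ENNReal.ofReal ‖v‖ := by
  obtain ⟨h, hh, he⟩ := (SmoothPath.segment v).exists_mem_lieGroup_sig (m := m) le_rfl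
    zero_le_one le_rfl
  refine ⟨h, hh, ?_, ?_⟩
  · rw [he]; exact SmoothPath.segment_sig v
  · rw [he, ← SmoothPath.segment_length]; exact ccNorm_sig_le _ le_rfl zero_le_one le_rfl

theorem isReachable_ι (v : V) : IsReachable 0 (TruncTensor.ι V m v) := by
  refine ⟨fun c => ENNReal.ofReal ‖c • v‖, fun _ => ENNReal.ofReal_ne_top, ?_, fun c => ?_⟩
  · exact (ENNReal.continuous_ofReal.comp (by fun_prop)).tendsto' _ _ (by simp)
  · simpa using exists_mem_lieGroup_segment (m := m) (c • v)

omit [FiniteDimensional ℝ V] in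
/-- The group commutator of `1 + a` and `1 + b` has leading term `[a, b]`. -/
theorem commutator_sub_one_sub_lie_mem {k : ℕ} {g h : (TruncTensor V m)ˣ}
    {x y : TruncTensor V m} (hx : x ∈ degFilt V m 1) (hy : y ∈ degFilt V m (k + 1))
    (hg : (g : TruncTensor V m) - 1 - x ∈ degFilt V m 2)
    (hh : (h : TruncTensor V m) - 1 - y ∈ degFilt V m (k + 2))
    (hgh : ((g⁻¹ * h⁻¹ : (TruncTensor V m)ˣ) : TruncTensor V m) - 1 ∈ degFilt V m 1) :
    ((g * h * g⁻¹ * h⁻¹ : (TruncTensor V m)ˣ) : TruncTensor V m) - 1 - ⁅x, y⁆ ∈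
      degFilt V m (k + 3) := by
  have hg' : (g : TruncTensor V m) - 1 ∈ degFilt V m 1 := by
    simpa using add_mem (degFilt_anti (by omega) hg) hx
  have hh' : (h : TruncTensor V m) - 1 ∈ degFilt V m (k + 1) := by
    simpa using add_mem (degFilt_anti (by omega) hh) hy
  set a := (g : TruncTensor V m) - 1 with ha
  set b := (h : TruncTensor V m) - 1 with hb
  set w := ((g⁻¹ * h⁻¹ : (TruncTensor V m)ˣ) : TruncTensor V m) with hw
  have hcomm : ((g * h * g⁻¹ * h⁻¹ : (TruncTensor V m)ˣ) : TruncTensor V m) - 1 = ⁅a, b⁆ * w := by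
    have h1 : (h * g * (g⁻¹ * h⁻¹ : (TruncTensor V m)ˣ) : TruncTensor V m) = 1 := by
      rw [← Units.val_mul, ← Units.val_mul]; simp
    have h2 : ⁅a, b⁆ = (g * h - h * g : TruncTensor V m) := by
      rw [LieRing.of_associative_ring_bracket, ha, hb]; noncomm_ring
    rw [h2, sub_mul, h1, hw, ← Units.val_mul, ← Units.val_mul, mul_assoc (g * h)]
  clear_value a b w
  have e : ⁅a, b⁆ * w - ⁅x, y⁆ = ⁅a, b⁆ * (w - 1) + (⁅a - x, b⁆ + ⁅x, b - y⁆) := by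
    rw [sub_lie, lie_sub, mul_sub, mul_one]; abel
  rw [hcomm, e]
  refine add_mem (degFilt_anti (by omega) (mul_mem_degFilt (lie_mem_degFilt hg' hh') hgh))
    (add_mem (degFilt_anti (by omega) (lie_mem_degFilt hg hh'))
      (degFilt_anti (by omega) (lie_mem_degFilt hx hh)))

theorem IsReachable.lie {k : ℕ} {r : TruncTensor V m} (hr : IsReachable k r)
    (hr' : r ∈ lieDeg V m k) (v : V) : IsReachable (k + 1) ⁅TruncTensor.ι V m v, r⁆ := by
  obtain ⟨ρ, hρ, hρ0, h⟩ := hr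
  -- the factor `c` is shared evenly: `c [v, r] = [√|c| v, (c / √|c|) r]`
  refine ⟨fun c => 2 * (ENNReal.ofReal ‖√|c| • v‖ + ρ (c / √|c|)),
    fun c => ENNReal.mul_ne_top (by simp)
      (ENNReal.add_ne_top.2 ⟨ENNReal.ofReal_ne_top, hρ _⟩), ?_, fun c => ?_⟩
  · have h1 : Filter.Tendsto (fun c : ℝ => ENNReal.ofReal ‖√|c| • v‖) (𝓝 0) (𝓝 0) :=
      (ENNReal.continuous_ofReal.comp (by fun_prop)).tendsto' _ _ (by simp)
    have h2 : Filter.Tendsto (fun c : ℝ => c / √|c|) (𝓝 0) (𝓝 0) := by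
      refine squeeze_zero_norm (a := fun c : ℝ => √|c|) (fun c => le_of_eq ?_)
        (Continuous.tendsto' (by fun_prop) _ _ (by simp))
      rw [norm_div, Real.norm_eq_abs, Real.norm_eq_abs, abs_of_nonneg (Real.sqrt_nonneg _),
        Real.div_sqrt]
    have h3 := ENNReal.Tendsto.const_mul (a := 2) (h1.add (hρ0.comp h2)) (Or.inr (by simp))
    simpa using h3
  · obtain ⟨A, hA, hA1, hA2⟩ := exists_mem_lieGroup_segment (m := m) (√|c| • v)
    obtain ⟨B, hB, hB1, hB2⟩ := h (c / √|c|)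
    refine ⟨A * B * A⁻¹ * B⁻¹,
      mul_mem (mul_mem (mul_mem hA hB) (inv_mem hA)) (inv_mem hB), ?_, ?_⟩
    · have hc : c • ⁅TruncTensor.ι V m v, r⁆ =
          ⁅TruncTensor.ι V m (√|c| • v), (c / √|c|) • r⁆ := by
        rw [map_smul, smul_lie, lie_smul, smul_smul]
        congr 1
        rcases eq_or_ne c 0 with rfl | hc
        · simp
        · have : √|c| ≠ 0 := (Real.sqrt_pos.2 (abs_pos.2 hc)).ne'
          field_simp
      rw [hc]
      exact commutator_sub_one_sub_lie_mem (ι_mem_degFilt_one _)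
        (Submodule.smul_mem _ _ (lieDeg_le_degFilt k hr')) hA1 hB1
        (sub_one_mem_of_mem_lieGroup (mul_mem (inv_mem hA) (inv_mem hB)))
    · simp only [Units.val_mul]
      refine (ccNorm_mul_le _ _).trans ((add_le_add_left ((ccNorm_mul_le _ _).trans
        (add_le_add_left (ccNorm_mul_le _ _) _)) _).trans ?_)
      rw [ccNorm_inv, ccNorm_inv, two_mul, add_assoc (_ + _)]
      exact add_le_add (add_le_add hA2 hB2) (add_le_add hA2 hB2)

theorem isReachable_of_mem_lieDeg {k : ℕ} {r : TruncTensor V m} (hr : r ∈ lieDeg V m k) :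
    IsReachable k r := by
  induction k generalizing r with
  | zero => obtain ⟨v, rfl⟩ := hr; exact isReachable_ι v
  | succ k ih =>
    rw [lieDeg] at hr
    induction hr using Submodule.span_induction with
    | mem x hx => obtain ⟨v, r, hr, rfl⟩ := hx; exact (ih hr).lie hr v
    | zero => exact isReachable_zero _
    | add x y hx hy hx' hy' => exact hx'.add hy' hx hy
    | smul a x _ hx => exact hx.smul a

/-- The homogeneous component of degree `k + 1` is linear on
`lieDeg V m k ⊔ degFilt V m (k + 2)`. -/
theorem exists_linearMap_lieDeg (V : Type*) [NormedAddCommGroup V] [NormedSpace ℝ V]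
    [FiniteDimensional ℝ V] (m k : ℕ) : ∃ L : TruncTensor V m →ₗ[ℝ] lieDeg V m k,
    ∀ x ∈ lieDeg V m k ⊔ degFilt V m (k + 2), x - L x ∈ degFilt V m (k + 2) := by
  let q := (degFilt V m (k + 2)).mkQ ∘ₗ (lieDeg V m k).subtype
  have hq : LinearMap.ker q = ⊥ := by
    rw [LinearMap.ker_eq_bot']
    intro r hr
    have hr' : (r : TruncTensor V m) ∈ degFilt V m (k + 2) := by simpa [q] using hr
    exact Subtype.ext (eq_zero_of_degDer_eq_smul (degDer_of_mem_lieDeg r.2) hr')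
  obtain ⟨l, hl⟩ := LinearMap.exists_leftInverse_of_injective q hq
  refine ⟨l ∘ₗ (degFilt V m (k + 2)).mkQ, fun x hx => ?_⟩
  obtain ⟨r, hr, w, hw, rfl⟩ := Submodule.mem_sup.1 hx
  have h1 : (degFilt V m (k + 2)).mkQ (r + w) = q ⟨r, hr⟩ := by
    rw [map_add, (Submodule.Quotient.mk_eq_zero _).2 hw |> fun h => (show
      (degFilt V m (k + 2)).mkQ w = 0 from h), add_zero]
    rfl
  have h2 : l (q ⟨r, hr⟩) = ⟨r, hr⟩ := DFunLike.congr_fun hl _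
  rw [LinearMap.comp_apply, h1, h2]
  simpa using hw

/-- Each Lie leading term `z` of degree `k + 1` is the leading term of a group element whose norm
is controlled by a function of `z` that is finite and vanishes at `0`. -/
theorem exists_reach (V : Type*) [NormedAddCommGroup V] [NormedSpace ℝ V]
    [FiniteDimensional ℝ V] (m k : ℕ) : ∃ Ω : TruncTensor V m → ℝ≥0∞, (∀ z, Ω z ≠ ⊤) ∧
    Filter.Tendsto Ω (𝓝 0) (𝓝 0) ∧ ∀ z ∈ lieDeg V m k ⊔ degFilt V m (k + 2),
      ∃ h ∈ lieGroup V m, (h : TruncTensor V m) - 1 - z ∈ degFilt V m (k + 2) ∧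
        ccNorm m (h : TruncTensor V m) ≤ Ω z := by
  obtain ⟨L, hL⟩ := exists_linearMap_lieDeg V m k
  let b := Module.finBasis ℝ (lieDeg V m k)
  choose ρ hρ hρ0 hreach using fun j => isReachable_of_mem_lieDeg (b j).2
  let c : Fin _ → TruncTensor V m →ₗ[ℝ] ℝ := fun j => b.coord j ∘ₗ L
  have key : ∀ (s : Finset (Fin _)) (z : TruncTensor V m), ∃ h ∈ lieGroup V m,
      (h : TruncTensor V m) - 1 - ∑ j ∈ s, c j z • (b j : TruncTensor V m) ∈
        degFilt V m (k + 2) ∧ ccNorm m (h : TruncTensor V m) ≤ ∑ j ∈ s, ρ j (c j z) := by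
    intro s z
    induction s using Finset.induction_on with
    | empty => exact ⟨1, one_mem _, by simp, by simp [ccNorm_one]⟩
    | insert j s hj ih =>
      obtain ⟨h, hh, h1, h2⟩ := ih
      obtain ⟨g, hg, g1, g2⟩ := hreach j (c j z)
      refine ⟨g * h, mul_mem hg hh, ?_, ?_⟩
      · rw [Finset.sum_insert hj, Units.val_mul]
        exact mul_sub_one_sub_add_mem (Submodule.smul_mem _ _ (lieDeg_le_degFilt k (b j).2))
          (sum_mem fun i _ => Submodule.smul_mem _ _ (lieDeg_le_degFilt k (b i).2)) g1 h1
      · rw [Finset.sum_insert hj, Units.val_mul]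
        exact (ccNorm_mul_le _ _).trans (add_le_add g2 h2)
  refine ⟨fun z => ∑ j, ρ j (c j z), fun z => ENNReal.sum_ne_top.2 fun j _ => hρ j _, ?_,
    fun z hz => ?_⟩
  · have := tendsto_finsetSum (Finset.univ) fun j _ => (hρ0 j).comp
      ((LinearMap.continuous_of_finiteDimensional (c j)).tendsto' 0 0 (map_zero _))
    simpa using this
  · obtain ⟨h, hh, h1, h2⟩ := key Finset.univ z
    refine ⟨h, hh, ?_, h2⟩
    have hz' : ∑ j, c j z • (b j : TruncTensor V m) = L z := by
      have := congrArg (lieDeg V m k).subtype (b.sum_repr (L z))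
      rwa [map_sum] at this
    rw [hz'] at h1
    have := sub_mem h1 (hL z hz)
    rwa [sub_sub_sub_cancel_right] at this

/-- The leading term of an element of `lieGroup V m` is a Lie element. -/
theorem sub_one_mem_of_mem_lieGroup_of_mem_degFilt {g : (TruncTensor V m)ˣ}
    (hg : g ∈ lieGroup V m) {k : ℕ} (hk : (g : TruncTensor V m) - 1 ∈ degFilt V m (k + 1)) :
    (g : TruncTensor V m) - 1 ∈ lieDeg V m k ⊔ degFilt V m (k + 2) := by
  set x := (g : TruncTensor V m) - 1 with hx
  have h1 : degDer V m (g : TruncTensor V m) = degDer V m x := by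
    rw [hx, map_sub, degDer_one, sub_zero]
  have h2 := degDer_sub_smul_mem hk
  have h3 : degDer V m x * ((g⁻¹ : (TruncTensor V m)ˣ) : TruncTensor V m) - degDer V m x ∈
      degFilt V m (k + 2) := by
    have := mul_mem_degFilt (degDer_mem_degFilt hk)
      (sub_one_mem_of_mem_lieGroup (inv_mem hg))
    rwa [mul_sub, mul_one] at this
  have hz : degDer V m x * ((g⁻¹ : (TruncTensor V m)ˣ) : TruncTensor V m) ∈
      lieDeg V m k ⊔ degFilt V m (k + 2) :=
    mem_lieDeg_sup_degFilt (h1 ▸ hg.2.2) (degFilt_mul_right (degDer_mem_degFilt hk) _)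
  have h4 : ((k + 1 : ℕ) : ℝ) • x ∈ lieDeg V m k ⊔ degFilt V m (k + 2) := by
    have h5 : _ ∈ lieDeg V m k ⊔ degFilt V m (k + 2) :=
      Submodule.mem_sup_right (add_mem h3 h2)
    have := sub_mem hz h5
    rwa [sub_add_sub_cancel, sub_sub_cancel] at this
  exact (Submodule.smul_mem_iff _ (by positivity)).1 h4

/-- Chow's theorem, by descending induction on the degree of the leading term: the elements of
`lieGroup V m` have finite Carnot–Carathéodory norm, which is small near `1`. -/
theorem ccNorm_lieGroup_aux (i : ℕ) :
    (∀ g ∈ lieGroup V m, (g : TruncTensor V m) - 1 ∈ degFilt V m (m + 1 - i) →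
      ccNorm m (g : TruncTensor V m) < ⊤) ∧
    ∀ ε : ℝ≥0∞, 0 < ε → ∀ᶠ x in 𝓝 (1 : TruncTensor V m), ∀ g ∈ lieGroup V m,
      (g : TruncTensor V m) = x → x - 1 ∈ degFilt V m (m + 1 - i) → ccNorm m x < ε := by
  induction i with
  | zero =>
    have h0 : ∀ x : TruncTensor V m, x - 1 ∈ degFilt V m (m + 1 - 0) → ccNorm m x = 0 := by
      intro x hx
      rw [Nat.sub_zero, degFilt_eq_bot m.lt_succ_self, Submodule.mem_bot, sub_eq_zero] at hx
      rw [hx, ccNorm_one]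
    exact ⟨fun g _ hx => by simp [h0 _ hx], fun ε hε => .of_forall fun x _ _ _ hx => by
      rwa [h0 x hx]⟩
  | succ i ih =>
    obtain ⟨ih1, ih2⟩ := ih
    rcases Nat.lt_or_ge m (i + 1) with hi | hi
    · -- below degree `1` there is nothing new
      have hF : ∀ g ∈ lieGroup V m, (g : TruncTensor V m) - 1 ∈ degFilt V m (m + 1 - i) :=
        fun g hg => degFilt_anti (by omega) (sub_one_mem_of_mem_lieGroup hg)
      refine ⟨fun g hg _ => ih1 g hg (hF g hg), fun ε hε => ?_⟩
      filter_upwards [ih2 ε hε] with x hx g hg hgx _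
      exact hx g hg hgx (hgx ▸ hF g hg)
    · obtain ⟨k, hk, hk'⟩ : ∃ k, m + 1 - (i + 1) = k + 1 ∧ m + 1 - i = k + 2 :=
        ⟨m - i - 1, by omega, by omega⟩
      rw [hk]
      rw [hk'] at ih1 ih2
      obtain ⟨Ω, hΩ, hΩ0, hreach⟩ := exists_reach V m k
      -- `g h⁻¹`, with `h` of the same leading term as `g`, is in the next filtration step
      have step : ∀ g ∈ lieGroup V m, (g : TruncTensor V m) - 1 ∈ degFilt V m (k + 1) →
          ∃ h ∈ lieGroup V m, ccNorm m (h : TruncTensor V m) ≤ Ω ((g : TruncTensor V m) - 1) ∧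
            ((g * h⁻¹ : (TruncTensor V m)ˣ) : TruncTensor V m) - 1 ∈ degFilt V m (k + 2) := by
        intro g hg hgk
        obtain ⟨h, hh, h1, h2⟩ :=
          hreach _ (sub_one_mem_of_mem_lieGroup_of_mem_degFilt hg hgk)
        refine ⟨h, hh, h2, ?_⟩
        rw [sub_sub_sub_cancel_right] at h1
        have := degFilt_mul_right (neg_mem h1) ((h⁻¹ : (TruncTensor V m)ˣ) : TruncTensor V m)
        rwa [neg_sub, sub_mul, Units.mul_inv, ← Units.val_mul] at this
      have hsplit : ∀ g h : (TruncTensor V m)ˣ, ccNorm m (g : TruncTensor V m) ≤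
          ccNorm m ((g * h⁻¹ : (TruncTensor V m)ˣ) : TruncTensor V m) +
            ccNorm m (h : TruncTensor V m) := fun g h => by
        simpa using ccNorm_mul_le (m := m) ((g * h⁻¹ : (TruncTensor V m)ˣ) : TruncTensor V m) h
      refine ⟨fun g hg hgk => ?_, fun ε hε => ?_⟩
      · obtain ⟨h, hh, h1, h2⟩ := step g hg hgk
        exact (hsplit g h).trans_lt (ENNReal.add_lt_top.2
          ⟨ih1 _ (mul_mem hg (inv_mem hh)) h2, h1.trans_lt (hΩ _).lt_top⟩)
      · have hε2 : 0 < ε / 2 := ENNReal.half_pos hε.ne'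
        have hmul : Filter.Tendsto (fun p : TruncTensor V m × TruncTensor V m => p.1 * p.2)
            (𝓝 1 ×ˢ 𝓝 1) (𝓝 1) := by
          rw [← nhds_prod_eq]
          exact continuous_mul.tendsto' _ _ (mul_one 1)
        obtain ⟨N, hN, W, hW, hNW⟩ := Filter.mem_prod_iff.1 (hmul (ih2 _ hε2))
        obtain ⟨η, hη, hηW⟩ := exists_forall_ccNorm_lt_mem hW
        have hΩ1 : Filter.Tendsto (fun x : TruncTensor V m => Ω (x - 1)) (𝓝 1) (𝓝 0) :=
          hΩ0.comp ((continuous_sub_right 1).tendsto' _ _ (sub_self _))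
        filter_upwards [hN, hΩ1.eventually_lt_const (lt_min hη hε2)] with x hxN hxΩ g hg hgx hgk
        subst hgx
        obtain ⟨h, hh, h1, h2⟩ := step g hg hgk
        have h3 := h1.trans_lt hxΩ
        have hW' : ((h⁻¹ : (TruncTensor V m)ˣ) : TruncTensor V m) ∈ W :=
          hηW _ (by rw [ccNorm_inv]; exact h3.trans_le (min_le_left _ _))
        have h4 := hNW (Set.mk_mem_prod hxN hW') (g * h⁻¹) (mul_mem hg (inv_mem hh))
          (by simp) (by simpa using h2)
        refine (hsplit g h).trans_lt ?_
        rw [← ENNReal.add_halves ε]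
        exact ENNReal.add_lt_add (by simpa using h4) (h3.trans_le (min_le_right _ _))

theorem ccNorm_lt_top {g : (TruncTensor V m)ˣ} (hg : g ∈ lieGroup V m) :
    ccNorm m (g : TruncTensor V m) < ⊤ :=
  (ccNorm_lieGroup_aux (m + 1)).1 g hg (by rw [Nat.sub_self]; exact mem_degFilt_zero _)

theorem eventually_ccNorm_lt {ε : ℝ≥0∞} (hε : 0 < ε) : ∀ᶠ x in 𝓝 (1 : TruncTensor V m),
    ∀ g ∈ lieGroup V m, (g : TruncTensor V m) = x → ccNorm m x < ε := by
  filter_upwards [(ccNorm_lieGroup_aux (m + 1)).2 ε hε] with x hx g hg hgx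
  exact hx g hg hgx (by rw [Nat.sub_self]; exact mem_degFilt_zero _)

/-! ### Controls -/

/-- The sums of `f` along strictly increasing chains from `0` to `s`. -/
def chainSums (f : ℝ → ℝ → ℝ≥0∞) (s : ℝ) : Set ℝ≥0∞ :=
  {c | ∃ (n : ℕ) (t : Fin (n + 1) → ℝ), StrictMono t ∧ t 0 = 0 ∧ t (Fin.last n) = s ∧
    ∑ i : Fin n, f (t i.castSucc) (t i.succ) = c}

theorem zero_mem_chainSums (f : ℝ → ℝ → ℝ≥0∞) : 0 ∈ chainSums f 0 :=
  ⟨0, fun _ => 0, Subsingleton.strictMono (α := Fin 1) _, rfl, rfl, by simp⟩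

theorem add_mem_chainSums {f : ℝ → ℝ → ℝ≥0∞} {s t : ℝ} {c : ℝ≥0∞} (hst : s < t)
    (hc : c ∈ chainSums f s) : c + f s t ∈ chainSums f t := by
  obtain ⟨n, u, hu, hu0, hun, rfl⟩ := hc
  refine ⟨n + 1, Fin.snoc u t, ?_, ?_, ?_, ?_⟩
  · refine Fin.strictMono_iff_lt_succ.2 fun i => ?_
    induction i using Fin.lastCases with
    | last => simpa [hun] using hst
    | cast i =>
      rw [Fin.succ_castSucc, Fin.snoc_castSucc, Fin.snoc_castSucc]
      exact hu Fin.castSucc_lt_succ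
  · rw [← Fin.castSucc_zero, Fin.snoc_castSucc, hu0]
  · simp
  · rw [Fin.sum_univ_castSucc]
    congr 1
    · refine Finset.sum_congr rfl fun i _ => ?_
      rw [Fin.succ_castSucc, Fin.snoc_castSucc, Fin.snoc_castSucc]
    · simp [hun]

theorem chainSums_nonempty (f : ℝ → ℝ → ℝ≥0∞) {s : ℝ} (hs : 0 ≤ s) : (chainSums f s).Nonempty := by
  rcases hs.eq_or_lt with rfl | hs
  · exact ⟨0, zero_mem_chainSums f⟩
  · exact ⟨_, add_mem_chainSums hs (zero_mem_chainSums f)⟩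

/-- If the sums of `f` along subdivisions are bounded, `f` is dominated by the increments of a
function: the supremum of the sums along chains from `0`. -/
theorem exists_control {f : ℝ → ℝ → ℝ≥0∞} {M : ℝ≥0∞} (hf : ∀ s ∈ Set.Icc (0 : ℝ) 1, f s s = 0)
    (hM : ∀ D : Subdivision, ∑ i : Fin D.n, f (D.t i.castSucc) (D.t i.succ) ≤ M) :
    ∃ Φ : ℝ → ℝ≥0∞, Φ 1 ≤ M ∧ ∀ s t, 0 ≤ s → s ≤ t → t ≤ 1 → Φ s + f s t ≤ Φ t := by
  refine ⟨fun s => sSup (chainSums f s), sSup_le ?_, fun s t h0 hst h1 => ?_⟩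
  · rintro _ ⟨n, t, ht, ht0, htn, rfl⟩
    exact hM ⟨n, t, ht, ht0, htn⟩
  · rcases hst.eq_or_lt with rfl | hlt
    · rw [hf s ⟨h0, h1⟩, add_zero]
    · rw [ENNReal.sSup_add (chainSums_nonempty f h0)]
      exact iSup₂_le fun c hc => le_sSup (add_mem_chainSums hlt hc)

theorem add_sum_le_of_add_le {W : ℝ → ℝ≥0∞} {f : ℝ → ℝ → ℝ≥0∞} {n : ℕ} (t : Fin (n + 1) → ℝ)
    (h : ∀ i : Fin n, W (t i.castSucc) + f (t i.castSucc) (t i.succ) ≤ W (t i.succ)) :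
    W (t 0) + ∑ i : Fin n, f (t i.castSucc) (t i.succ) ≤ W (t (Fin.last n)) := by
  induction n with
  | zero => simp
  | succ n ih =>
    rw [Fin.sum_univ_castSucc, ← add_assoc]
    refine le_trans ?_ (h (Fin.last n))
    gcongr
    exact ih (fun i => t i.castSucc) fun i => h i.castSucc

theorem sum_le_of_add_le {W : ℝ → ℝ≥0∞} {f : ℝ → ℝ → ℝ≥0∞}
    (h : ∀ s t, 0 ≤ s → s ≤ t → t ≤ 1 → W s + f s t ≤ W t) (D : Subdivision) :
    ∑ i : Fin D.n, f (D.t i.castSucc) (D.t i.succ) ≤ W 1 := by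
  have := add_sum_le_of_add_le (W := W) D.t fun i =>
    h _ _ (D.nonneg _) (D.lt_succ i).le (D.le_one _)
  rw [D.t_last] at this
  exact le_add_self.trans this

/-- Every point of `[0,1]` lies in an interval of the subdivision. -/
theorem Subdivision.exists_mem_Icc (D : Subdivision) {s : ℝ} (hs : s ∈ Set.Icc (0 : ℝ) 1) :
    ∃ i : Fin D.n, s ∈ Set.Icc (D.t i.castSucc) (D.t i.succ) := by
  have key : ∀ (n : ℕ) (t : Fin (n + 1) → ℝ), t 0 < t (Fin.last n) → t 0 ≤ s →
      s ≤ t (Fin.last n) → ∃ i : Fin n, s ∈ Set.Icc (t i.castSucc) (t i.succ) := by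
    intro n
    induction n with
    | zero => intro t h; exact absurd h (lt_irrefl _)
    | succ n ih =>
      intro t _ h0 h1
      rcases le_or_gt (t (Fin.last n).castSucc) s with hs | hs
      · exact ⟨Fin.last n, hs, h1⟩
      · obtain ⟨i, hi⟩ := ih (fun i => t i.castSucc) (h0.trans_lt hs) h0 hs.le
        exact ⟨i.castSucc, hi⟩
  exact key D.n D.t (by rw [D.t_zero, D.t_last]; exact one_pos) (by rw [D.t_zero]; exact hs.1)
    (by rw [D.t_last]; exact hs.2)

theorem Subdivision.sub_le_mesh (D : Subdivision) (i : Fin D.n) :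
    D.t i.succ - D.t i.castSucc ≤ D.mesh :=
  le_ciSup (f := fun i : Fin D.n => D.t i.succ - D.t i.castSucc) (Set.finite_range _).bddAbove i

theorem Subdivision.mesh_uniform (n : ℕ) : (uniform n).mesh = 1 / ((n : ℝ) + 1) := by
  have : ∀ i : Fin (uniform n).n,
      (uniform n).t i.succ - (uniform n).t i.castSucc = 1 / ((n : ℝ) + 1) := by
    intro i
    change ((i.succ : ℕ) : ℝ) / (n + 1) - ((i.castSucc : ℕ) : ℝ) / (n + 1) = _
    rw [Fin.val_succ, Fin.val_castSucc]
    push_cast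
    ring
  have hne : Nonempty (Fin (uniform n).n) := inferInstanceAs (Nonempty (Fin (n + 1)))
  simp only [mesh, this, ciSup_const]

/-! ### Paths of units -/

/-- `U` represents the path `Y` on `[0,1]` by elements of `lieGroup V m`. -/
def Represents (U : ℝ → (TruncTensor V m)ˣ) (Y : ℝ → TruncTensor V m) : Prop :=
  ∀ t ∈ Set.Icc (0 : ℝ) 1, U t ∈ lieGroup V m ∧ (U t : TruncTensor V m) = Y t

theorem IsGroupPath.exists_represents {Y : ℝ → TruncTensor V m} (hY : IsGroupPath m Y) :
    ∃ U, Represents U Y := by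
  have : ∀ t, ∃ u : (TruncTensor V m)ˣ, t ∈ Set.Icc (0 : ℝ) 1 →
      u ∈ lieGroup V m ∧ (u : TruncTensor V m) = Y t := fun t => by
    by_cases ht : t ∈ Set.Icc (0 : ℝ) 1
    · obtain ⟨u, hu⟩ := exists_mem_lieGroup_of_mem_freeNilGroup (hY.mem t ht)
      exact ⟨u, fun _ => hu⟩
    · exact ⟨1, fun h => absurd h ht⟩
  choose U hU using this
  exact ⟨U, hU⟩

theorem SmoothPath.exists_represents (y : SmoothPath V) (m : ℕ) :
    ∃ U, Represents U (y.sigPath m) := by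
  have : ∀ t, ∃ u : (TruncTensor V m)ˣ, t ∈ Set.Icc (0 : ℝ) 1 →
      u ∈ lieGroup V m ∧ (u : TruncTensor V m) = y.sigPath m t := fun t => by
    by_cases ht : t ∈ Set.Icc (0 : ℝ) 1
    · obtain ⟨u, hu⟩ := y.exists_mem_lieGroup_sig (m := m) le_rfl ht.1 ht.2
      exact ⟨u, fun _ => hu⟩
    · exact ⟨1, fun h => absurd h ht⟩
  choose U hU using this
  exact ⟨U, hU⟩

variable {Y : ℝ → TruncTensor V m} {U : ℝ → (TruncTensor V m)ˣ}

theorem Represents.incr_eq (hU : Represents U Y) {s t : ℝ} (hs : s ∈ Set.Icc (0 : ℝ) 1)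
    (ht : t ∈ Set.Icc (0 : ℝ) 1) :
    incr Y s t = (((U s)⁻¹ * U t : (TruncTensor V m)ˣ) : TruncTensor V m) := by
  rw [incr, ← (hU s hs).2, ← (hU t ht).2, Ring.inverse_unit, Units.val_mul]

theorem Represents.incr_mem (hU : Represents U Y) {s t : ℝ} (hs : s ∈ Set.Icc (0 : ℝ) 1)
    (ht : t ∈ Set.Icc (0 : ℝ) 1) : (U s)⁻¹ * U t ∈ lieGroup V m :=
  mul_mem (inv_mem (hU s hs).1) (hU t ht).1

theorem Represents.coe_inv (hU : Represents U Y) {t : ℝ} (ht : t ∈ Set.Icc (0 : ℝ) 1) :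
    (((U t)⁻¹ : (TruncTensor V m)ˣ) : TruncTensor V m) = nilInv (Y t) := by
  rw [inv_eq_nilInv (sub_one_mem_of_mem_lieGroup (hU t ht).1), (hU t ht).2]

/-- The Carnot–Carathéodory norm of a unit. -/
def unitNorm (g : (TruncTensor V m)ˣ) : ℝ≥0∞ := ccNorm m (g : TruncTensor V m)

theorem unitNorm_one : unitNorm (1 : (TruncTensor V m)ˣ) = 0 := ccNorm_one

theorem unitNorm_mul_le (g h : (TruncTensor V m)ˣ) :
    unitNorm (g * h) ≤ unitNorm g + unitNorm h := by
  rw [unitNorm, Units.val_mul]; exact ccNorm_mul_le _ _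

theorem unitNorm_inv (g : (TruncTensor V m)ˣ) : unitNorm g⁻¹ = unitNorm g := ccNorm_inv g

theorem Represents.ccNorm_incr (hU : Represents U Y) {s t : ℝ} (hs : s ∈ Set.Icc (0 : ℝ) 1)
    (ht : t ∈ Set.Icc (0 : ℝ) 1) : ccNorm m (incr Y s t) = unitNorm ((U s)⁻¹ * U t) := by
  rw [hU.incr_eq hs ht, unitNorm]

theorem Represents.ccDist_incr_one (hU : Represents U Y) {s t : ℝ} (hs : s ∈ Set.Icc (0 : ℝ) 1)
    (ht : t ∈ Set.Icc (0 : ℝ) 1) :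
    ccDist m (incr Y s t) (incr (fun _ => 1) s t) = unitNorm ((U s)⁻¹ * U t) := by
  rw [hU.incr_eq hs ht, ccDist, incr, Ring.inverse_unit, Ring.inverse_one, mul_one, mul_one,
    ccNorm_inv, unitNorm]

theorem Represents.ccDist_incr {X : ℝ → TruncTensor V m} {Z : ℝ → (TruncTensor V m)ˣ}
    (hZ : Represents Z X) (hU : Represents U Y) {s t : ℝ} (hs : s ∈ Set.Icc (0 : ℝ) 1)
    (ht : t ∈ Set.Icc (0 : ℝ) 1) :
    ccDist m (incr X s t) (incr Y s t) = unitNorm (((Z s)⁻¹ * Z t)⁻¹ * ((U s)⁻¹ * U t)) := by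
  rw [hZ.incr_eq hs ht, hU.incr_eq hs ht, ccDist, Ring.inverse_unit, ← Units.val_mul, unitNorm]

theorem Subdivision.mem_Icc (D : Subdivision) (i : Fin (D.n + 1)) :
    D.t i ∈ Set.Icc (0 : ℝ) 1 := ⟨D.nonneg i, D.le_one i⟩

theorem Represents.pVarNorm_eq (hU : Represents U Y) (p : ℝ) :
    pVarNorm m p Y = ⨆ D : Subdivision,
      (∑ i : Fin D.n, unitNorm ((U (D.t i.castSucc))⁻¹ * U (D.t i.succ)) ^ p) ^ (1 / p) := by
  rw [pVarNorm, pVarDist]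
  refine iSup_congr fun D => ?_
  congr 1
  refine Finset.sum_congr rfl fun i _ => ?_
  rw [hU.ccDist_incr_one (D.mem_Icc _) (D.mem_Icc _)]

theorem eq_one_of_ccNorm_eq_zero {g : TruncTensor V m} (hg : ccNorm m g = 0) : g = 1 := by
  by_contra h
  obtain ⟨η, hη, hU⟩ := exists_forall_ccNorm_lt_mem
    (isOpen_compl_singleton.mem_nhds (show (1 : TruncTensor V m) ∈ ({g} : Set _)ᶜ from
      fun h' => h h'.symm))
  exact hU g (hg ▸ hη) rfl

/-- The Carnot–Carathéodory norm is continuous on `lieGroup V m`. -/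
theorem tendsto_unitNorm {g : ℕ → (TruncTensor V m)ˣ} {h : (TruncTensor V m)ˣ}
    (hg : ∀ n, g n ∈ lieGroup V m) (hh : h ∈ lieGroup V m)
    (hlim : Filter.Tendsto (fun n => (g n : TruncTensor V m)) Filter.atTop (𝓝 h)) :
    Filter.Tendsto (fun n => unitNorm (g n)) Filter.atTop (𝓝 (unitNorm h)) := by
  rw [ENNReal.tendsto_nhds (show unitNorm h ≠ ⊤ from (ccNorm_lt_top hh).ne)]
  intro ε hε
  have h1 : Filter.Tendsto (fun n => (((g n)⁻¹ * h : (TruncTensor V m)ˣ) : TruncTensor V m))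
      Filter.atTop (𝓝 1) := by
    have h2 : nilInv (h : TruncTensor V m) * h = 1 :=
      nilInv_mul (sub_one_mem_of_mem_lieGroup hh)
    rw [← h2]
    refine (((continuous_nilInv.tendsto _).comp hlim).mul_const _).congr fun n => ?_
    rw [Units.val_mul, inv_eq_nilInv (sub_one_mem_of_mem_lieGroup (hg n))]
    rfl
  filter_upwards [h1.eventually (eventually_ccNorm_lt hε)] with n hn
  have h3 : unitNorm ((g n)⁻¹ * h) < ε := hn _ (mul_mem (inv_mem (hg n)) hh) rfl
  constructor
  · rw [tsub_le_iff_right]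
    calc unitNorm h = unitNorm (g n * ((g n)⁻¹ * h)) := by rw [mul_inv_cancel_left]
      _ ≤ unitNorm (g n) + unitNorm ((g n)⁻¹ * h) := unitNorm_mul_le _ _
      _ ≤ unitNorm (g n) + ε := by gcongr
  · calc unitNorm (g n) = unitNorm (h * ((g n)⁻¹ * h)⁻¹) := by group
      _ ≤ unitNorm h + unitNorm ((g n)⁻¹ * h)⁻¹ := unitNorm_mul_le _ _
      _ ≤ unitNorm h + ε := by rw [unitNorm_inv]; gcongr

/-- Finite `p`-variation passes to pointwise limits of signatures. -/
theorem pVarNorm_le_of_tendsto {p : ℝ} (hY : IsGroupPath m Y) (y : ℕ → SmoothPath V) {C : ℝ≥0∞}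
    (hC : ∀ n, pVarNorm m p ((y n).sigPath m) ≤ C)
    (hlim : ∀ t ∈ Set.Icc (0 : ℝ) 1,
      Filter.Tendsto (fun n => (y n).sigPath m t) Filter.atTop (𝓝 (Y t))) :
    pVarNorm m p Y ≤ C := by
  obtain ⟨U, hU⟩ := hY.exists_represents
  choose Z hZ using fun n => (y n).exists_represents m
  rw [hU.pVarNorm_eq]
  refine iSup_le fun D => ?_
  have hterm : ∀ i : Fin D.n, Filter.Tendsto
      (fun n => unitNorm ((Z n (D.t i.castSucc))⁻¹ * Z n (D.t i.succ))) Filter.atTop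
      (𝓝 (unitNorm ((U (D.t i.castSucc))⁻¹ * U (D.t i.succ)))) := by
    intro i
    have hs := D.mem_Icc i.castSucc
    have ht := D.mem_Icc i.succ
    refine tendsto_unitNorm (fun n => (hZ n).incr_mem hs ht) (hU.incr_mem hs ht) ?_
    simp only [Units.val_mul, (hZ _).coe_inv hs, hU.coe_inv hs, ((hZ _) _ ht).2, (hU _ ht).2]
    exact ((continuous_nilInv.tendsto _).comp (hlim _ hs)).mul (hlim _ ht)
  refine le_of_tendsto ((ENNReal.continuous_rpow_const.tendsto _).comp
    (tendsto_finsetSum Finset.univ fun i _ =>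
      (ENNReal.continuous_rpow_const (y := p)).tendsto _ |>.comp (hterm i)))
    (.of_forall fun n => ?_)
  refine le_trans ?_ (hC n)
  rw [(hZ n).pVarNorm_eq]
  exact le_iSup (fun D : Subdivision => (∑ i : Fin D.n,
    unitNorm ((Z n (D.t i.castSucc))⁻¹ * Z n (D.t i.succ)) ^ p) ^ (1 / p)) D

/-! ### Interpolation by almost-geodesics -/

theorem exists_isAlmostGeodesicInterpolation (hY : IsGroupPath m Y) (D : Subdivision) :
    ∃ y, IsAlmostGeodesicInterpolation m Y D y := by
  obtain ⟨U, hU⟩ := hY.exists_represents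
  have hgeo : ∀ g ∈ lieGroup V m, ∃ y : SmoothPath V, y.sig m 0 1 = (g : TruncTensor V m) ∧
      y.length 0 1 ≤ 2 * ccNorm m (g : TruncTensor V m) := by
    intro g hg
    rcases eq_or_ne (ccNorm m (g : TruncTensor V m)) 0 with h0 | h0
    · -- the neutral element is the signature of the constant path
      have hl : (SmoothPath.segment (0 : V)).length 0 1 = 0 := by
        simp [SmoothPath.segment_length]
      refine ⟨SmoothPath.segment 0, ?_, by simp [hl]⟩
      rw [eq_one_of_ccNorm_eq_zero h0]
      exact eq_one_of_ccNorm_eq_zero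
        (le_antisymm ((ccNorm_sig_le _ le_rfl zero_le_one le_rfl).trans hl.le) zero_le)
    · have hlt : ccNorm m (g : TruncTensor V m) < 2 * ccNorm m (g : TruncTensor V m) := by
        rw [two_mul]
        exact ENNReal.lt_add_right (ccNorm_lt_top hg).ne h0
      obtain ⟨y, hy, hl⟩ := ccNorm_lt_iff.1 hlt
      exact ⟨y, hy, hl.le⟩
  choose y hy hl using fun i : Fin D.n =>
    hgeo _ (hU.incr_mem (D.mem_Icc i.castSucc) (D.mem_Icc i.succ))
  obtain ⟨z, hz⟩ := SmoothPath.exists_concat D y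
  refine ⟨z, fun i => ?_⟩
  rw [(hz i).1 m, (hz i).2, hU.incr_eq (D.mem_Icc _) (D.mem_Icc _)]
  exact ⟨hy i, hl i⟩

section Interpolation

variable {D : Subdivision} {y : SmoothPath V} {Z : ℝ → (TruncTensor V m)ˣ}

/-- The signature of an interpolation agrees with `Y` at the points of the subdivision. -/
theorem IsAlmostGeodesicInterpolation.eq_knot (hy : IsAlmostGeodesicInterpolation m Y D y)
    (hY0 : Y 0 = 1) (hU : Represents U Y) (hZ : Represents Z (y.sigPath m))
    (i : Fin (D.n + 1)) : Z (D.t i) = U (D.t i) := by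
  have h0 : (0 : ℝ) ∈ Set.Icc (0 : ℝ) 1 := ⟨le_rfl, zero_le_one⟩
  induction i using Fin.induction with
  | zero =>
    rw [D.t_zero]
    ext
    rw [(hU 0 h0).2, (hZ 0 h0).2, hY0]
    exact y.sig_self 0
  | succ i ih =>
    have h1 := (hy i).1
    rw [← y.incr_sigPath (D.nonneg _) (D.lt_succ i).le (D.le_one _),
      hZ.incr_eq (D.mem_Icc _) (D.mem_Icc _), hU.incr_eq (D.mem_Icc _) (D.mem_Icc _)] at h1
    have h2 := Units.ext h1
    rw [ih] at h2
    exact mul_left_cancel h2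

theorem Represents.unitNorm_le_length (hZ : Represents Z (y.sigPath m)) {s t : ℝ} (h0 : 0 ≤ s)
    (hst : s ≤ t) (h1 : t ≤ 1) : unitNorm ((Z s)⁻¹ * Z t) ≤ y.length s t := by
  rw [unitNorm, ← hZ.incr_eq ⟨h0, hst.trans h1⟩ ⟨h0.trans hst, h1⟩, y.incr_sigPath h0 hst h1]
  exact ccNorm_sig_le y h0 hst h1

/-- On an interval of the subdivision, `ℓ ^ (p - 1)` times the arc length, `ℓ` being the length
over that interval, controls the `p`-th power of the arc length. Adding up these functions and a
control of the `p`-variation of `Y` gives a function `W` whose increments control both `Y` and its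
interpolation. -/
theorem IsAlmostGeodesicInterpolation.exists_control
    (hy : IsAlmostGeodesicInterpolation m Y D y) (hY0 : Y 0 = 1) (hU : Represents U Y)
    (hZ : Represents Z (y.sigPath m)) {p : ℝ} (hp : 1 ≤ p) {M : ℝ≥0∞}
    (hMtop : M ≠ ⊤) (hM : ∀ D : Subdivision,
      ∑ i : Fin D.n, unitNorm ((U (D.t i.castSucc))⁻¹ * U (D.t i.succ)) ^ p ≤ M) :
    ∃ W : ℝ → ℝ≥0∞, W 1 ≤ (1 + 2 ^ p) * M ∧
      (∀ s t, 0 ≤ s → s ≤ t → t ≤ 1 → W s ≤ W t) ∧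
      (∀ s t, 0 ≤ s → s ≤ t → t ≤ 1 → unitNorm ((U s)⁻¹ * U t) ≤ (W t - W s) ^ (1 / p)) ∧
      ∀ s t, 0 ≤ s → s ≤ t → t ≤ 1 → unitNorm ((Z s)⁻¹ * Z t) ≤ 3 * (W t - W s) ^ (1 / p) := by
  have hp0 : 0 < p := one_pos.trans_le hp
  obtain ⟨Φ, hΦ1, hΦ⟩ := GeometricRoughPath.exists_control
    (f := fun s t => unitNorm ((U s)⁻¹ * U t) ^ p)
    (fun s _ => by simp [unitNorm_one, hp0]) hM
  let ℓ : Fin D.n → ℝ≥0∞ := fun i => y.length (D.t i.castSucc) (D.t i.succ)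
  have hℓ : ∀ i, ℓ i ≤ 2 * unitNorm ((U (D.t i.castSucc))⁻¹ * U (D.t i.succ)) := fun i => by
    rw [← hU.ccNorm_incr (D.mem_Icc _) (D.mem_Icc _)]
    exact (hy i).2
  let ψ : Fin D.n → ℝ → ℝ≥0∞ := fun i t =>
    ℓ i ^ (p - 1) * y.length (D.t i.castSucc) (min t (D.t i.succ))
  have hψmono : ∀ i s t, s ≤ t → ψ i s ≤ ψ i t := fun i s t hst =>
    mul_le_mul_right (y.length_mono le_rfl (min_le_min_right _ hst)) _
  have hpow : ∀ x : ℝ≥0∞, x ^ (p - 1) * x = x ^ p := fun x => by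
    conv_rhs => rw [show p = (p - 1) + 1 by ring,
      ENNReal.rpow_add_of_nonneg _ _ (by linarith) zero_le_one, ENNReal.rpow_one]
  have hψcell : ∀ i s t, D.t i.castSucc ≤ s → s ≤ t → t ≤ D.t i.succ →
      ψ i s + y.length s t ^ p ≤ ψ i t := by
    intro i s t hs hst ht
    simp only [ψ]
    rw [min_eq_left ht, min_eq_left (hst.trans ht),
      ← y.length_add (D.nonneg _) hs hst (ht.trans (D.le_one _)), mul_add, ← hpow]
    gcongr
    exact y.length_mono hs ht
  have hψ1 : ∀ i, ψ i 1 ≤ 2 ^ p * unitNorm ((U (D.t i.castSucc))⁻¹ * U (D.t i.succ)) ^ p := by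
    intro i
    simp only [ψ]
    rw [min_eq_right (D.le_one _), ← ENNReal.mul_rpow_of_nonneg _ _ hp0.le]
    change ℓ i ^ (p - 1) * ℓ i ≤ _
    rw [hpow]
    exact ENNReal.rpow_le_rpow (hℓ i) hp0.le
  let Ψ : ℝ → ℝ≥0∞ := fun t => ∑ i, ψ i t
  have hΨmono : ∀ s t, s ≤ t → Ψ s ≤ Ψ t := fun s t hst =>
    Finset.sum_le_sum fun i _ => hψmono i s t hst
  have hΨ1 : Ψ 1 ≤ 2 ^ p * M := by
    refine (Finset.sum_le_sum fun i _ => hψ1 i).trans ?_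
    rw [← Finset.mul_sum]
    gcongr
    exact hM D
  have hΦmono : ∀ s t, 0 ≤ s → s ≤ t → t ≤ 1 → Φ s ≤ Φ t := fun s t h0 hst h1 =>
    le_self_add.trans (hΦ s t h0 hst h1)
  let W : ℝ → ℝ≥0∞ := fun t => Φ t + Ψ t
  have hW1 : W 1 ≤ (1 + 2 ^ p) * M := by
    rw [add_mul, one_mul]; exact add_le_add hΦ1 hΨ1
  have hWmono : ∀ s t, 0 ≤ s → s ≤ t → t ≤ 1 → W s ≤ W t := fun s t h0 hst h1 =>
    add_le_add (hΦmono s t h0 hst h1) (hΨmono s t hst)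
  have hWtop : ∀ s, 0 ≤ s → s ≤ 1 → W s ≠ ⊤ := fun s h0 h1 =>
    ((hWmono s 1 h0 h1 le_rfl).trans hW1).trans_lt
      (ENNReal.mul_lt_top (by simp [ENNReal.rpow_lt_top_of_nonneg hp0.le]) hMtop.lt_top) |>.ne
  have hroot : ∀ s t a, 0 ≤ s → s ≤ 1 → W s + a ^ p ≤ W t → a ≤ (W t - W s) ^ (1 / p) :=
    fun s t a h0 h1 h => by
    rw [one_div]
    exact (ENNReal.le_rpow_inv_iff hp0).2
      (ENNReal.le_sub_of_add_le_left (hWtop s h0 h1) h)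
  have hΔ : ∀ s a b t, 0 ≤ s → s ≤ a → a ≤ b → b ≤ t → t ≤ 1 →
      (W b - W a) ^ (1 / p) ≤ (W t - W s) ^ (1 / p) := fun s a b t h0 hsa hab hbt h1 =>
    ENNReal.rpow_le_rpow (tsub_le_tsub (hWmono b t (by linarith) hbt h1)
      (hWmono s a h0 hsa (by linarith))) (by positivity)
  have hWY : ∀ s t, 0 ≤ s → s ≤ t → t ≤ 1 →
      unitNorm ((U s)⁻¹ * U t) ≤ (W t - W s) ^ (1 / p) := fun s t h0 hst h1 => by
    refine hroot s t _ h0 (hst.trans h1) ?_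
    calc W s + _ = (Φ s + unitNorm ((U s)⁻¹ * U t) ^ p) + Ψ s := by simp only [W]; ring
      _ ≤ W t := add_le_add (hΦ s t h0 hst h1) (hΨmono s t hst)
  have hcell : ∀ (i : Fin D.n) (s t : ℝ), D.t i.castSucc ≤ s → s ≤ t → t ≤ D.t i.succ →
      unitNorm ((Z s)⁻¹ * Z t) ≤ (W t - W s) ^ (1 / p) := by
    intro i s t hs hst ht
    have h0 : 0 ≤ s := (D.nonneg _).trans hs
    have h1 : t ≤ 1 := ht.trans (D.le_one _)
    refine (hZ.unitNorm_le_length h0 hst h1).trans (hroot s t _ h0 (hst.trans h1) ?_)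
    have h2 : Ψ s + y.length s t ^ p ≤ Ψ t := by
      simp only [Ψ]
      rw [← Finset.add_sum_erase Finset.univ (fun i => ψ i s) (Finset.mem_univ i),
        ← Finset.add_sum_erase Finset.univ (fun i => ψ i t) (Finset.mem_univ i), add_right_comm]
      exact add_le_add (hψcell i s t hs hst ht)
        (Finset.sum_le_sum fun j _ => hψmono j s t hst)
    calc W s + y.length s t ^ p = Φ s + (Ψ s + y.length s t ^ p) := by simp only [W]; ring
      _ ≤ W t := add_le_add (hΦmono s t h0 hst h1) h2
  refine ⟨W, hW1, hWmono, hWY, fun s t h0 hst h1 => ?_⟩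
  obtain ⟨i, hi⟩ := D.exists_mem_Icc ⟨h0, hst.trans h1⟩
  obtain ⟨j, hj⟩ := D.exists_mem_Icc ⟨h0.trans hst, h1⟩
  rcases lt_trichotomy i j with hij | rfl | hij
  · -- split the increment at the first and the last point of the subdivision in `[s, t]`
    have hab : D.t i.succ ≤ D.t j.castSucc :=
      D.strictMono.monotone (Fin.succ_le_castSucc_iff.2 hij)
    have e : (Z s)⁻¹ * Z t = (Z s)⁻¹ * Z (D.t i.succ) *
        ((U (D.t i.succ))⁻¹ * U (D.t j.castSucc)) * ((Z (D.t j.castSucc))⁻¹ * Z t) := by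
      rw [← hy.eq_knot hY0 hU hZ, ← hy.eq_knot hY0 hU hZ]
      group
    have h3 : ∀ x : ℝ≥0∞, 3 * x = x + x + x := fun x => by ring
    rw [e, h3]
    refine (unitNorm_mul_le _ _).trans (add_le_add ((unitNorm_mul_le _ _).trans
      (add_le_add ?_ ?_)) ?_)
    · exact (hcell i _ _ hi.1 hi.2 le_rfl).trans (hΔ _ _ _ _ h0 le_rfl hi.2 (hab.trans hj.1) h1)
    · exact (hWY _ _ (D.nonneg _) hab (D.le_one _)).trans (hΔ _ _ _ _ h0 hi.2 hab hj.1 h1)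
    · exact (hcell j _ _ le_rfl hj.1 hj.2).trans (hΔ _ _ _ _ h0 (hi.2.trans hab) hj.1 le_rfl h1)
  · refine (hcell i s t hi.1 hst hj.2).trans (le_mul_of_one_le_left zero_le (by norm_num))
  · have hba : D.t j.succ ≤ D.t i.castSucc :=
      D.strictMono.monotone (Fin.succ_le_castSucc_iff.2 hij)
    obtain rfl : s = t := le_antisymm hst (hj.2.trans (hba.trans hi.1))
    simp [unitNorm_one]

theorem sum_rpow_le_of_le_mul {W : ℝ → ℝ≥0∞} {f : ℝ → ℝ → ℝ≥0∞} {p : ℝ} {K : ℝ≥0∞} (hp : 0 < p)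
    (hW : ∀ s t, 0 ≤ s → s ≤ t → t ≤ 1 → W s ≤ W t)
    (hf : ∀ s t, 0 ≤ s → s ≤ t → t ≤ 1 → f s t ≤ K * (W t - W s) ^ (1 / p)) (E : Subdivision) :
    ∑ i : Fin E.n, f (E.t i.castSucc) (E.t i.succ) ^ p ≤ K ^ p * W 1 := by
  have h1 : ∀ s t, 0 ≤ s → s ≤ t → t ≤ 1 → f s t ^ p ≤ K ^ p * (W t - W s) := by
    intro s t h0 hst h1
    refine (ENNReal.rpow_le_rpow (hf s t h0 hst h1) hp.le).trans_eq ?_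
    rw [ENNReal.mul_rpow_of_nonneg _ _ hp.le, ← ENNReal.rpow_mul, one_div_mul_cancel hp.ne',
      ENNReal.rpow_one]
  calc ∑ i : Fin E.n, f (E.t i.castSucc) (E.t i.succ) ^ p
      ≤ ∑ i : Fin E.n, K ^ p * (W (E.t i.succ) - W (E.t i.castSucc)) :=
        Finset.sum_le_sum fun i _ => h1 _ _ (E.nonneg _) (E.lt_succ i).le (E.le_one _)
    _ = K ^ p * ∑ i : Fin E.n, (W (E.t i.succ) - W (E.t i.castSucc)) := (Finset.mul_sum _ _ _).symm
    _ ≤ K ^ p * W 1 := by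
        gcongr
        exact sum_le_of_add_le (f := fun s t => W t - W s)
          (fun s t h0 hst h1 => (add_tsub_cancel_of_le (hW s t h0 hst h1)).le) E

end Interpolation

/-! ### Uniform closeness of fine interpolations -/

theorem IsGroupPath.continuousOn_nilInv_mul (hY : IsGroupPath m Y) :
    ContinuousOn (fun q : ℝ × ℝ => nilInv (Y q.1) * Y q.2) (Set.Icc 0 1 ×ˢ Set.Icc 0 1) :=
  (continuous_nilInv.comp_continuousOn
    (hY.continuousOn.comp continuousOn_fst fun _ hq => hq.1)).mul
    (hY.continuousOn.comp continuousOn_snd fun _ hq => hq.2)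

/-- Uniform continuity of a path for the Carnot–Carathéodory distance. -/
theorem IsGroupPath.exists_unitNorm_incr_lt (hY : IsGroupPath m Y) (hU : Represents U Y)
    {ε : ℝ≥0∞} (hε : 0 < ε) : ∃ δ > 0, ∀ s ∈ Set.Icc (0 : ℝ) 1, ∀ t ∈ Set.Icc (0 : ℝ) 1,
      |s - t| < δ → unitNorm ((U s)⁻¹ * U t) < ε := by
  have hF := hY.continuousOn_nilInv_mul
  have hFU : ∀ s ∈ Set.Icc (0 : ℝ) 1, ∀ t ∈ Set.Icc (0 : ℝ) 1,
      (((U s)⁻¹ * U t : (TruncTensor V m)ˣ) : TruncTensor V m) =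
        nilInv (Y s) * Y t := fun s hs t ht => by
    rw [Units.val_mul, hU.coe_inv hs, (hU t ht).2]
  obtain ⟨ρ, hρ, hball⟩ := Metric.mem_nhds_iff.1 (eventually_ccNorm_lt (V := V) (m := m) hε)
  obtain ⟨δ, hδ, h⟩ := Metric.uniformContinuousOn_iff.1
    ((isCompact_Icc.prod isCompact_Icc).uniformContinuousOn_of_continuous hF) ρ hρ
  refine ⟨δ, hδ, fun s hs t ht hst => ?_⟩
  have h1 := h (s, t) ⟨hs, ht⟩ (s, s) ⟨hs, hs⟩ (by
    rw [Prod.dist_eq, dist_self, max_eq_right dist_nonneg, Real.dist_eq, abs_sub_comm]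
    exact hst)
  simp only at h1
  rw [← hFU s hs t ht, ← hFU s hs s hs, inv_mul_cancel, Units.val_one] at h1
  exact hball (Metric.mem_ball.2 h1) _ (hU.incr_mem hs ht) rfl

/-- Conjugation by the increments of a path is equicontinuous at `1`. -/
theorem IsGroupPath.exists_unitNorm_conj_lt (hY : IsGroupPath m Y) (hU : Represents U Y)
    {ε : ℝ≥0∞} (hε : 0 < ε) : ∃ η > 0, ∀ h ∈ lieGroup V m, unitNorm h < η →
      ∀ s ∈ Set.Icc (0 : ℝ) 1, ∀ t ∈ Set.Icc (0 : ℝ) 1,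
        unitNorm (((U s)⁻¹ * U t)⁻¹ * h * ((U s)⁻¹ * U t)) < ε := by
  obtain ⟨ρ, hρ, hball⟩ := Metric.mem_nhds_iff.1 (eventually_ccNorm_lt (V := V) (m := m) hε)
  have hF := hY.continuousOn_nilInv_mul
  obtain ⟨B, hB⟩ := (isCompact_Icc.prod isCompact_Icc).exists_bound_of_continuousOn hF
  have hFU : ∀ s ∈ Set.Icc (0 : ℝ) 1, ∀ t ∈ Set.Icc (0 : ℝ) 1,
      ‖(((U s)⁻¹ * U t : (TruncTensor V m)ˣ) : TruncTensor V m)‖ ≤ B := fun s hs t ht => by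
    rw [Units.val_mul, hU.coe_inv hs, (hU t ht).2]
    exact hB (s, t) ⟨hs, ht⟩
  set μ := ‖mulCLM V m‖ with hμ
  have hμ0 : 0 ≤ μ := (mulCLM V m).opNorm_nonneg
  have hB0 : 0 ≤ B := (norm_nonneg _).trans
    (hFU 0 ⟨le_rfl, zero_le_one⟩ 0 ⟨le_rfl, zero_le_one⟩)
  have hK : 0 < μ * μ * B * B + 1 := by positivity
  obtain ⟨η, hη, hηU⟩ := exists_forall_ccNorm_lt_mem
    (Metric.ball_mem_nhds (1 : TruncTensor V m) (div_pos hρ hK))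
  refine ⟨η, hη, fun h hh hhη s hs t ht => ?_⟩
  have h1 : ‖(h : TruncTensor V m) - 1‖ < ρ / (μ * μ * B * B + 1) := by
    simpa [dist_eq_norm] using hηU _ hhη
  have hinv : ((U s)⁻¹ * U t)⁻¹ = (U t)⁻¹ * U s := by group
  set k := (U s)⁻¹ * U t with hk
  refine hball ?_ _ (mul_mem (mul_mem (inv_mem (hU.incr_mem hs ht)) hh) (hU.incr_mem hs ht)) rfl
  rw [Metric.mem_ball, dist_eq_norm]
  have e : ((k⁻¹ * h * k : (TruncTensor V m)ˣ) : TruncTensor V m) - 1 =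
      (k⁻¹ : (TruncTensor V m)ˣ) * ((h : TruncTensor V m) - 1) * k := by
    rw [mul_sub, sub_mul, mul_one, Units.inv_mul, Units.val_mul, Units.val_mul]
  rw [e]
  have hk1 : ‖((k⁻¹ : (TruncTensor V m)ˣ) : TruncTensor V m)‖ ≤ B := by
    rw [hinv]; exact hFU t ht s hs
  have hk2 : ‖(k : TruncTensor V m)‖ ≤ B := hFU s hs t ht
  calc ‖((k⁻¹ : (TruncTensor V m)ˣ) : TruncTensor V m) * ((h : TruncTensor V m) - 1) * k‖
      ≤ μ * (μ * ‖((k⁻¹ : (TruncTensor V m)ˣ) : TruncTensor V m)‖ *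
          ‖(h : TruncTensor V m) - 1‖) * ‖(k : TruncTensor V m)‖ :=
        (norm_mul_le_mulCLM _ _).trans (by gcongr; exact norm_mul_le_mulCLM _ _)
    _ ≤ μ * (μ * B * ‖(h : TruncTensor V m) - 1‖) * B := by gcongr
    _ = μ * μ * B * B * ‖(h : TruncTensor V m) - 1‖ := by ring
    _ ≤ (μ * μ * B * B + 1) * ‖(h : TruncTensor V m) - 1‖ := by gcongr; linarith
    _ < (μ * μ * B * B + 1) * (ρ / (μ * μ * B * B + 1)) := by gcongr
    _ = ρ := mul_div_cancel₀ _ hK.ne'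

/-- Interpolations along fine subdivisions are uniformly close to `Y`: for left neighbours `a`, `b`
of `s`, `t` in the subdivision, where `Z` and `U` agree, the error `Z_{s,t}⁻¹ U_{s,t}` is the
product of `Z_{b,t}⁻¹ U_{b,t}` and of a conjugate of `Z_{a,s} U_{a,s}⁻¹` by `U_{a,t}`. -/
theorem IsGroupPath.exists_forall_mesh_lt (hY : IsGroupPath m Y) (hU : Represents U Y)
    {ε : ℝ≥0∞} (hε : 0 < ε) : ∃ δ > 0, ∀ (D : Subdivision) (y : SmoothPath V)
      (Z : ℝ → (TruncTensor V m)ˣ), D.mesh < δ → IsAlmostGeodesicInterpolation m Y D y →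
      Represents Z (y.sigPath m) → ∀ s ∈ Set.Icc (0 : ℝ) 1, ∀ t ∈ Set.Icc (0 : ℝ) 1,
        unitNorm (((Z s)⁻¹ * Z t)⁻¹ * ((U s)⁻¹ * U t)) < ε := by
  have hε2 : 0 < ε / 2 := ENNReal.half_pos hε.ne'
  obtain ⟨η, hη, hconj⟩ := hY.exists_unitNorm_conj_lt hU hε2
  -- the bound `1` keeps `κ` finite, so that strict inequalities can be added
  set κ := min (min η (ε / 2)) 1 with hκ
  have hκ3 : 0 < κ / 3 := ENNReal.div_pos (lt_min (lt_min hη hε2) one_pos).ne' (by simp)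
  obtain ⟨δ, hδ, hosc⟩ := hY.exists_unitNorm_incr_lt hU hκ3
  refine ⟨δ, hδ, fun D y Z hD hy hZ s hs t ht => ?_⟩
  -- within an interval of the subdivision both paths have small increments
  have hcell : ∀ (i : Fin D.n), ∀ r ∈ Set.Icc (D.t i.castSucc) (D.t i.succ),
      unitNorm ((Z (D.t i.castSucc))⁻¹ * Z r) ≤ 2 * (κ / 3) ∧
      unitNorm ((U (D.t i.castSucc))⁻¹ * U r) < κ / 3 := by
    intro i r hr
    have hr1 : r ≤ 1 := hr.2.trans (D.le_one _)
    have hmesh := D.sub_le_mesh i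
    have hlt := D.lt_succ i
    constructor
    · refine (hZ.unitNorm_le_length (D.nonneg _) hr.1 hr1).trans
        ((y.length_mono le_rfl hr.2).trans ((hy i).2.trans ?_))
      rw [hU.ccNorm_incr (D.mem_Icc _) (D.mem_Icc _)]
      gcongr
      refine (hosc _ (D.mem_Icc _) _ (D.mem_Icc _) ?_).le
      rw [abs_lt]; constructor <;> linarith
    · refine hosc _ (D.mem_Icc _) _ ⟨(D.nonneg _).trans hr.1, hr1⟩ ?_
      obtain ⟨hr0, hr2⟩ := hr
      rw [abs_lt]; constructor <;> linarith
  have hκtop : κ / 3 + κ / 3 + κ / 3 = κ := ENNReal.add_thirds κ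
  have hκfin : κ / 3 ≠ ⊤ :=
    ENNReal.div_ne_top (ne_top_of_le_ne_top ENNReal.one_ne_top (min_le_right _ _)) (by simp)
  have hsum : ∀ x y : ℝ≥0∞, x ≤ 2 * (κ / 3) → y < κ / 3 → x + y < κ := by
    intro x y hx hy
    rw [← hκtop, ← two_mul]
    exact ENNReal.add_lt_add_of_le_of_lt
      (ne_top_of_le_ne_top (ENNReal.mul_ne_top (by simp) hκfin) hx) hx hy
  obtain ⟨i, hi⟩ := D.exists_mem_Icc hs
  obtain ⟨j, hj⟩ := D.exists_mem_Icc ht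
  set a := D.t i.castSucc with ha
  set b := D.t j.castSucc with hb
  have hZa : Z a = U a := hy.eq_knot hY.zero hU hZ _
  have hZb : Z b = U b := hy.eq_knot hY.zero hU hZ _
  set k := (Z a)⁻¹ * Z s * ((U a)⁻¹ * U s)⁻¹ with hk
  have hk1 : unitNorm k < κ := by
    refine (unitNorm_mul_le _ _).trans_lt ?_
    rw [unitNorm_inv]
    exact hsum _ _ (hcell i s hi).1 (hcell i s hi).2
  have hkmem : k ∈ lieGroup V m :=
    mul_mem (hZ.incr_mem (D.mem_Icc _) hs) (inv_mem (hU.incr_mem (D.mem_Icc _) hs))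
  have e : ((Z s)⁻¹ * Z t)⁻¹ * ((U s)⁻¹ * U t) =
      ((Z b)⁻¹ * Z t)⁻¹ * ((U b)⁻¹ * U t) * (((U a)⁻¹ * U t)⁻¹ * k * ((U a)⁻¹ * U t)) := by
    rw [hk, hZa, hZb]
    group
  rw [e, ← ENNReal.add_halves ε]
  refine (unitNorm_mul_le _ _).trans_lt (ENNReal.add_lt_add ?_ ?_)
  · refine (unitNorm_mul_le _ _).trans_lt ?_
    rw [unitNorm_inv]
    exact (hsum _ _ (hcell j t hj).1 (hcell j t hj).2).trans_le
      ((min_le_left _ _).trans (min_le_right _ _))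
  · exact hconj k hkmem (hk1.trans_le ((min_le_left _ _).trans (min_le_left _ _))) a (D.mem_Icc _) t ht

/-! ### Convergence of interpolations -/

/-- Interpolation between the uniform distance and the `p`-variation. -/
theorem sum_rpow_le_of_lt {f : ℝ → ℝ → ℝ≥0∞} {p q : ℝ} {ε K : ℝ≥0∞} (hp : 0 < p) (hpq : p < q)
    (hε : ∀ s ∈ Set.Icc (0 : ℝ) 1, ∀ t ∈ Set.Icc (0 : ℝ) 1, f s t ≤ ε) (E : Subdivision)
    (hK : ∑ i : Fin E.n, f (E.t i.castSucc) (E.t i.succ) ^ p ≤ K) :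
    ∑ i : Fin E.n, f (E.t i.castSucc) (E.t i.succ) ^ q ≤ ε ^ (q - p) * K := by
  calc ∑ i : Fin E.n, f (E.t i.castSucc) (E.t i.succ) ^ q
      ≤ ∑ i : Fin E.n, ε ^ (q - p) * f (E.t i.castSucc) (E.t i.succ) ^ p := by
        refine Finset.sum_le_sum fun i _ => ?_
        rw [show q = (q - p) + p by ring, ENNReal.rpow_add_of_nonneg _ _ (by linarith) hp.le,
          show q - p + p - p = q - p by ring]
        gcongr
        exact hε _ (E.mem_Icc _) _ (E.mem_Icc _)
    _ = ε ^ (q - p) * ∑ i : Fin E.n, f (E.t i.castSucc) (E.t i.succ) ^ p :=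
        (Finset.mul_sum _ _ _).symm
    _ ≤ ε ^ (q - p) * K := by gcongr

/-- The `p`-variation of all interpolations, and their `p`-variation distance to `Y`, are bounded in
terms of the `p`-variation of `Y`. -/
theorem exists_forall_interpolation_le {p : ℝ} (hp : 1 ≤ p) (hY : IsGroupPath m Y)
    (hU : Represents U Y) (hfin : pVarNorm m p Y < ⊤) : ∃ K : ℝ≥0∞, K ≠ ⊤ ∧
      ∀ (D : Subdivision) (y : SmoothPath V) (Z : ℝ → (TruncTensor V m)ˣ),
        IsAlmostGeodesicInterpolation m Y D y → Represents Z (y.sigPath m) → ∀ E : Subdivision,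
          ∑ i : Fin E.n, unitNorm ((Z (E.t i.castSucc))⁻¹ * Z (E.t i.succ)) ^ p ≤ K ∧
          ∑ i : Fin E.n, unitNorm (((Z (E.t i.castSucc))⁻¹ * Z (E.t i.succ))⁻¹ *
            ((U (E.t i.castSucc))⁻¹ * U (E.t i.succ))) ^ p ≤ K := by
  have hp0 : 0 < p := one_pos.trans_le hp
  set M := pVarNorm m p Y ^ p with hMdef
  have hMtop : M ≠ ⊤ := ENNReal.rpow_ne_top_of_nonneg hp0.le hfin.ne
  have hM : ∀ D : Subdivision,
      ∑ i : Fin D.n, unitNorm ((U (D.t i.castSucc))⁻¹ * U (D.t i.succ)) ^ p ≤ M := fun D => by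
    rw [hMdef, ← ENNReal.rpow_inv_le_iff hp0, hU.pVarNorm_eq, ← one_div]
    exact le_iSup (fun D : Subdivision => (∑ i : Fin D.n,
      unitNorm ((U (D.t i.castSucc))⁻¹ * U (D.t i.succ)) ^ p) ^ (1 / p)) D
  refine ⟨4 ^ p * ((1 + 2 ^ p) * M), ?_, fun D y Z hy hZ E => ?_⟩
  · exact ENNReal.mul_ne_top (ENNReal.rpow_ne_top_of_nonneg hp0.le (by simp))
      (ENNReal.mul_ne_top (by simp) hMtop)
  · obtain ⟨W, hW1, hWmono, hWU, hWZ⟩ := hy.exists_control hY.zero hU hZ hp hMtop hM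
    have h34 : ∀ x : ℝ≥0∞, 3 * x + x = 4 * x := fun x => by ring
    constructor
    · refine (sum_rpow_le_of_le_mul (K := 4) (f := fun s t => unitNorm ((Z s)⁻¹ * Z t)) hp0 hWmono
        (fun s t h0 hst h1 => ?_) E).trans (by gcongr)
      rw [← h34]
      exact (hWZ s t h0 hst h1).trans le_self_add
    · refine (sum_rpow_le_of_le_mul (K := 4)
        (f := fun s t => unitNorm (((Z s)⁻¹ * Z t)⁻¹ * ((U s)⁻¹ * U t))) hp0 hWmono
        (fun s t h0 hst h1 => ?_) E).trans (by gcongr)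
      rw [← h34]
      refine (unitNorm_mul_le _ _).trans (add_le_add ?_ (hWU s t h0 hst h1))
      rw [unitNorm_inv]
      exact hWZ s t h0 hst h1

theorem Represents.pVarDist_eq {X : ℝ → TruncTensor V m} {Z : ℝ → (TruncTensor V m)ˣ}
    (hZ : Represents Z X) (hU : Represents U Y) (q : ℝ) : pVarDist m q X Y = ⨆ D : Subdivision,
      (∑ i : Fin D.n, unitNorm (((Z (D.t i.castSucc))⁻¹ * Z (D.t i.succ))⁻¹ *
        ((U (D.t i.castSucc))⁻¹ * U (D.t i.succ))) ^ q) ^ (1 / q) := by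
  rw [pVarDist]
  refine iSup_congr fun D => ?_
  congr 1
  refine Finset.sum_congr rfl fun i _ => ?_
  rw [hZ.ccDist_incr hU (D.mem_Icc _) (D.mem_Icc _)]

theorem exists_interpolations {p : ℝ} (hp : 1 ≤ p) (hY : Y ∈ CpVar V m p) (D : ℕ → Subdivision)
    (hD : Filter.Tendsto (fun n => (D n).mesh) Filter.atTop (𝓝 0)) :
    ∃ y : ℕ → SmoothPath V,
      (∀ n, IsAlmostGeodesicInterpolation m Y (D n) (y n)) ∧
      (∃ C : ℝ, ∀ n, pVarNorm m p ((y n).sigPath m) ≤ ENNReal.ofReal C) ∧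
      (∀ t ∈ Set.Icc (0 : ℝ) 1,
        Filter.Tendsto (fun n => (y n).sigPath m t) Filter.atTop (𝓝 (Y t))) ∧
      ∀ q : ℝ, p < q →
        Filter.Tendsto (fun n => pVarDist m q ((y n).sigPath m) Y) Filter.atTop (𝓝 0) := by
  obtain ⟨hYp, hfin⟩ := hY
  have hp0 : 0 < p := one_pos.trans_le hp
  have h01 : (0 : ℝ) ∈ Set.Icc (0 : ℝ) 1 := ⟨le_rfl, zero_le_one⟩
  obtain ⟨U, hU⟩ := hYp.exists_represents
  choose y hy using fun n => exists_isAlmostGeodesicInterpolation hYp (D n)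
  choose Z hZ using fun n => (y n).exists_represents m
  obtain ⟨K, hK, hKE⟩ := exists_forall_interpolation_le hp hYp hU hfin
  have hunif : ∀ ε : ℝ≥0∞, 0 < ε → ∀ᶠ n in Filter.atTop,
      ∀ s ∈ Set.Icc (0 : ℝ) 1, ∀ t ∈ Set.Icc (0 : ℝ) 1,
        unitNorm (((Z n s)⁻¹ * Z n t)⁻¹ * ((U s)⁻¹ * U t)) < ε := by
    intro ε hε
    obtain ⟨δ, hδ, h⟩ := hYp.exists_forall_mesh_lt hU hε
    filter_upwards [hD.eventually_lt_const hδ] with n hn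
    exact h (D n) (y n) (Z n) hn (hy n) (hZ n)
  refine ⟨y, hy, ⟨(K ^ (1 / p)).toReal, fun n => ?_⟩, fun t ht => ?_, fun q hq => ?_⟩
  · rw [ENNReal.ofReal_toReal (ENNReal.rpow_ne_top_of_nonneg (by positivity) hK),
      (hZ n).pVarNorm_eq]
    exact iSup_le fun E => ENNReal.rpow_le_rpow (hKE (D n) (y n) (Z n) (hy n) (hZ n) E).1
      (by positivity)
  · have hstart : ∀ n, Z n 0 = U 0 := fun n => by
      have := (hy n).eq_knot hYp.zero hU (hZ n) 0
      rwa [(D n).t_zero] at this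
    -- `X_t = Y_t w` with `w = (X_t⁻¹ Y_t)⁻¹` tending to `1`
    have hw : Filter.Tendsto
        (fun n => (((U t)⁻¹ * Z n t : (TruncTensor V m)ˣ) : TruncTensor V m)) Filter.atTop
        (𝓝 1) := by
      intro N hN
      rw [Filter.mem_map]
      obtain ⟨η, hη, hηN⟩ := exists_forall_ccNorm_lt_mem hN
      filter_upwards [hunif η hη] with n hn
      have h1 := hn 0 h01 t ht
      rw [hstart, show ((U 0)⁻¹ * Z n t)⁻¹ * ((U 0)⁻¹ * U t) = ((U t)⁻¹ * Z n t)⁻¹ by group,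
        unitNorm_inv] at h1
      exact hηN _ h1
    have h2 := hw.const_mul (Y t)
    rw [mul_one] at h2
    refine h2.congr fun n => ?_
    rw [← (hU t ht).2, ← Units.val_mul, mul_inv_cancel_left, (hZ n t ht).2]
  · have hq0 : 0 < q := hp0.trans hq
    have hlim : Filter.Tendsto (fun e : ℝ≥0∞ => (e ^ (q - p) * K) ^ (1 / q)) (𝓝 0) (𝓝 0) := by
      have h1 : Filter.Tendsto (fun e : ℝ≥0∞ => e ^ (q - p) * K) (𝓝 0) (𝓝 0) := by
        have := ENNReal.Tendsto.mul_const (b := K)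
          ((ENNReal.continuous_rpow_const (y := q - p)).tendsto 0) (Or.inr hK)
        simpa [ENNReal.zero_rpow_of_pos (sub_pos.2 hq)] using this
      have h2 := ((ENNReal.continuous_rpow_const (y := 1 / q)).tendsto 0).comp h1
      rwa [ENNReal.zero_rpow_of_pos (by positivity)] at h2
    rw [ENNReal.tendsto_nhds_zero]
    intro ε hε
    obtain ⟨e, he, he0⟩ := (((ENNReal.tendsto_nhds_zero.1 hlim ε hε).filter_mono
      nhdsWithin_le_nhds).and (self_mem_nhdsWithin (s := Set.Ioi (0 : ℝ≥0∞)))).exists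
    filter_upwards [hunif e he0] with n hn
    refine le_trans ?_ he
    rw [(hZ n).pVarDist_eq hU]
    refine iSup_le fun E => ENNReal.rpow_le_rpow ?_ (by positivity)
    exact sum_rpow_le_of_lt (f := fun s t =>
      unitNorm (((Z n s)⁻¹ * Z n t)⁻¹ * ((U s)⁻¹ * U t))) hp0 hq
      (fun s hs t ht => (hn s hs t ht).le) E (hKE (D n) (y n) (Z n) (hy n) (hZ n) E).2

end GeometricRoughPath

end

theorem mainTheorem1 {V : Type*} [NormedAddCommGroup V] [NormedSpace ℝ V]
    [FiniteDimensional ℝ V] (m : ℕ) (p : ℝ) (hp : 1 ≤ p)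
    (Y : ℝ → GeometricRoughPath.TruncTensor V m) (hY : GeometricRoughPath.IsGroupPath m Y) :
    (Y ∈ GeometricRoughPath.CpVar V m p ↔
      ∃ y : ℕ → GeometricRoughPath.SmoothPath V,
        (∃ C : ℝ, ∀ n, GeometricRoughPath.pVarNorm m p ((y n).sigPath m) ≤ ENNReal.ofReal C) ∧
        (∀ t ∈ Set.Icc (0 : ℝ) 1,
          Filter.Tendsto (fun n => (y n).sigPath m t) Filter.atTop (𝓝 (Y t)))) ∧
    (Y ∈ GeometricRoughPath.CpVar V m p →
      ∀ D : ℕ → GeometricRoughPath.Subdivision,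
        Filter.Tendsto (fun n => (D n).mesh) Filter.atTop (𝓝 0) →
        ∃ y : ℕ → GeometricRoughPath.SmoothPath V,
          (∀ n, GeometricRoughPath.IsAlmostGeodesicInterpolation m Y (D n) (y n)) ∧
          (∃ C : ℝ, ∀ n, GeometricRoughPath.pVarNorm m p ((y n).sigPath m) ≤ ENNReal.ofReal C) ∧
          (∀ t ∈ Set.Icc (0 : ℝ) 1,
            Filter.Tendsto (fun n => (y n).sigPath m t) Filter.atTop (𝓝 (Y t))) ∧
          ∀ q : ℝ, p < q →
            Filter.Tendsto (fun n => GeometricRoughPath.pVarDist m q ((y n).sigPath m) Y)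
              Filter.atTop (𝓝 0)) := by
  refine ⟨⟨fun h => ?_, ?_⟩, fun h D hD => GeometricRoughPath.exists_interpolations hp h D hD⟩
  · obtain ⟨y, -, hC, hlim, -⟩ := GeometricRoughPath.exists_interpolations hp h
      GeometricRoughPath.Subdivision.uniform (by
        simp only [GeometricRoughPath.Subdivision.mesh_uniform]
        exact tendsto_one_div_add_atTop_nhds_zero_nat)
    exact ⟨y, hC, hlim⟩
  · rintro ⟨y, ⟨C, hC⟩, hlim⟩
    exact ⟨hY, (GeometricRoughPath.pVarNorm_le_of_tendsto hY y hC hlim).trans_lt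
      ENNReal.ofReal_lt_top⟩
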